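/- Consider the linear $\lambda$-calculus $\mathcal{L}_{rec}$ with terms $$t ::= x \mid 0 \mid \mathsf{S}\,t \mid \mathsf{rec}\,t_1\,t_2\,t_3\,t_4 \mid t\,u \mid \lambda x.t \mid \langle t,u\rangle \mid \mathsf{let}\ t=\langle x,y\rangle\ \mathsf{in}\ u ,$$ modulo $\alpha$-equivalence and subject to linearity: the immediate subterms of a $\mathsf{rec}$, an application, a pair or a $\mathsf{let}$ have pairwise disjoint sets of free variables (for $\mathsf{let}$, after removing the bound $x,y$ from those of $u$), $x$ occurs free in $t$ in $\lambda x.t$, and $x,y$ occur free in $u$ in $\mathsf{let}\ t=\langle x,y\rangle\ \mathsf{in}\ u$. Reduction $\to$ is closed reduction, in any context: - $(\lambda x.t)\,v\to t[v/x]$ if $v$ is closed; - $\mathsf{let}\ \langle t,u\rangle=\langle x,y\rangle\ \mathsf{in}\ v\to v[t/x][u/y]$ if $t,u$ are closed; - $\mathsf{rec}\,\langle 0,t'\rangle\,u\,v\,w\to u$ if $t',v,w$ are closed; - $\mathsf{rec}\,\langle \mathsf{S}t,t'\rangle\,u\,v\,w\to v\,(\mathsf{rec}\,(w\,\langle t,t'\rangle)\,u\,v\,w)$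 if $v,w$ are closed. A term diverges if it does not reduce to a normal form. Write $\overline n=\mathsf{S}^n0$. Types are $A,B::=\mathbb{N}\mid A\multimap B\mid A\otimes B$, with the usual linear typing rules (contexts are split among the premises; exchange, but no weakening or contraction); the rule for the recursor gives $\mathsf{rec}\,t\,u\,v\,w : A$ from $t:\mathbb{N}\otimes\mathbb{N}$, $u:A$, $v:A\multimap A$ and $w:\mathbb{N}\otimes\mathbb{N}\multimap\mathbb{N}\otimes\mathbb{N}$. Put $I=\lambda x.x$, $\mathsf{snd}=\lambda x.\mathsf{let}\ x=\langle a,b\rangle\ \mathsf{in}\ \mathsf{rec}\,\langle a,0\rangle\,b\,I\,I$ and $C=\lambda x.\mathsf{rec}\,\langle x,0\rangle\,\langle 0,0\rangle\,(\lambda x.\mathsf{let}\ x=\langle a,b\rangle\ \mathsf{in}\ \langle \mathsf{S}a,\mathsf{S}b\rangle)\,I$. (1) Minimisation. Let $f:\mathbb{N}\to\mathbb{N}$ be a total function and $\overline f$ a closed $\mathcal{L}_{rec}$ term with $\overline f\,\overline n\to^*\overline{f(n)}$ for all $n$. Let $$M=\mathsf{rec}\,\langle\overline f\,0,0\rangle\,0\,(\lambda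 x.\mathsf{S}x)\,F,\qquad F=\lambda x.\mathsf{let}\ C(\mathsf{snd}\,x)=\langle y,z\rangle\ \mathsf{in}\ \langle\overline f(\mathsf{S}y),\mathsf{S}z\rangle .$$ Then $M$ is a closed $\mathcal{L}_{rec}$ term, of type $\mathbb{N}$ if $\overline f$ has type $\mathbb{N}\multimap\mathbb{N}$. If $f$ has a zero, then $M\to^*\overline m$ for $m=\min\{x\mid f(x)=0\}$; if $f$ has no zero, then $M$ diverges. (2) Turing completeness. For every $k\ge 0$ and every partial recursive function $h:\mathbb{N}^k\rightharpoonup\mathbb{N}$ there is a closed $\mathcal{L}_{rec}$ term $t$ of type $\mathbb{N}\multimap\cdots\multimap\mathbb{N}\multimap\mathbb{N}$ ($k$ arguments) such that, for all $x_1,\dots,x_k\in\mathbb{N}$, $t\,\overline{x_1}\cdots\overline{x_k}\to^*\overline{h(x_1,\dots,x_k)}$ if $h(x_1,\dots,x_k)$ is defined, and $t\,\overline{x_1}\cdots\overline{x_k}$ diverges otherwise. -/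

import Mathlib

namespace Lrec

/-- Raw terms, in de Bruijn notation: terms modulo renaming of bound variables.
`lam t` binds index `0` in `t`. `letp t u` is `let t = ⟨x, y⟩ in u`; in `u` the variable `x` has
index `1` and `y` has index `0`. `recur t u v w` is the unbounded recursor `rec t u v w`. -/
inductive Term : Type
  | var : ℕ → Term
  | zero : Term
  | succ : Term → Term
  | recur : Term → Term → Term → Term → Term
  | app : Term → Term → Term
  | lam : Term → Term
  | pair : Term → Term → Term
  | letp : Term → Term → Term

namespace Term

/-- `Free k t`: the variable with index `k` (counted outside `t`) occurs free in `t`. -/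
def Free : ℕ → Term → Prop
  | k, var i => i = k
  | _, zero => False
  | k, succ t => Free k t
  | k, recur t u v w => Free k t ∨ Free k u ∨ Free k v ∨ Free k w
  | k, app t u => Free k t ∨ Free k u
  | k, lam t => Free (k + 1) t
  | k, pair t u => Free k t ∨ Free k u
  | k, letp t u => Free k t ∨ Free (k + 2) u

/-- `fv t = ∅`. -/
def Closed (t : Term) : Prop := ∀ k, ¬ Free k t

/-- `fv t ∩ fv u = ∅`. -/
def Apart (t u : Term) : Prop := ∀ k, ¬ (Free k t ∧ Free k u)

/-- The variable constraints (syntactic linearity) that single out the terms of the calculus. -/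
def Linear : Term → Prop
  | var _ => True
  | zero => True
  | succ t => Linear t
  | recur t u v w => Linear t ∧ Linear u ∧ Linear v ∧ Linear w ∧
      Apart t u ∧ Apart t v ∧ Apart t w ∧ Apart u v ∧ Apart u w ∧ Apart v w
  | app t u => Linear t ∧ Linear u ∧ Apart t u
  | lam t => Linear t ∧ Free 0 t
  | pair t u => Linear t ∧ Linear u ∧ Apart t u
  | letp t u => Linear t ∧ Linear u ∧ Free 0 u ∧ Free 1 u ∧
      ∀ k, ¬ (Free k t ∧ Free (k + 2) u)

/-- Shift by one all free variables with index at least `c`. -/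
def lift : ℕ → Term → Term
  | c, var i => if i < c then var i else var (i + 1)
  | _, zero => zero
  | c, succ t => succ (lift c t)
  | c, recur t u v w => recur (lift c t) (lift c u) (lift c v) (lift c w)
  | c, app t u => app (lift c t) (lift c u)
  | c, lam t => lam (lift (c + 1) t)
  | c, pair t u => pair (lift c t) (lift c u)
  | c, letp t u => letp (lift c t) (lift (c + 2) u)

/-- Capture-avoiding substitution of `s` for the variable `k`, which is removed from the scope. -/
def subst : ℕ → Term → Term → Term
  | k, s, var i => if i < k then var i else if i = k then s else var (i - 1)
  | _, _, zero => zero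
  | k, s, succ t => succ (subst k s t)
  | k, s, recur t u v w => recur (subst k s t) (subst k s u) (subst k s v) (subst k s w)
  | k, s, app t u => app (subst k s t) (subst k s u)
  | k, s, lam t => lam (subst (k + 1) (lift 0 s) t)
  | k, s, pair t u => pair (subst k s t) (subst k s u)
  | k, s, letp t u => letp (subst k s t) (subst (k + 2) (lift 0 (lift 0 s)) u)

/-- One step of closed reduction, in any context. -/
inductive Step : Term → Term → Prop
  | beta {t v : Term} : Closed v → Step (app (lam t) v) (subst 0 v t)
  | letp_pair {t u v : Term} : Closed t → Closed u →
      Step (letp (pair t u) v) (subst 0 u (subst 1 (lift 0 t) v))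
  | rec_zero {t' u v w : Term} : Closed t' → Closed v → Closed w →
      Step (recur (pair zero t') u v w) u
  | rec_succ {t t' u v w : Term} : Closed v → Closed w →
      Step (recur (pair (succ t) t') u v w) (app v (recur (app w (pair t t')) u v w))
  | succ {t t' : Term} : Step t t' → Step (succ t) (succ t')
  | rec₁ {t t' u v w : Term} : Step t t' → Step (recur t u v w) (recur t' u v w)
  | rec₂ {t u u' v w : Term} : Step u u' → Step (recur t u v w) (recur t u' v w)
  | rec₃ {t u v v' w : Term} : Step v v' → Step (recur t u v w) (recur t u v' w)
  | rec₄ {t u v w w' : Term} : Step w w' → Step (recur t u v w) (recur t u v w')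
  | app₁ {t t' u : Term} : Step t t' → Step (app t u) (app t' u)
  | app₂ {t u u' : Term} : Step u u' → Step (app t u) (app t u')
  | lam {t t' : Term} : Step t t' → Step (lam t) (lam t')
  | pair₁ {t t' u : Term} : Step t t' → Step (pair t u) (pair t' u)
  | pair₂ {t u u' : Term} : Step u u' → Step (pair t u) (pair t u')
  | letp₁ {t t' u : Term} : Step t t' → Step (letp t u) (letp t' u)
  | letp₂ {t u u' : Term} : Step u u' → Step (letp t u) (letp t u')

/-- `t →* u`. -/
def Red : Term → Term → Prop := Relation.ReflTransGen Step

def IsNormal (t : Term) : Prop := ∀ u, ¬ Step t u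

/-- `t` diverges: it does not reduce to any normal form. -/
def Diverges (t : Term) : Prop := ¬ ∃ u, Red t u ∧ IsNormal u

/-- The numeral `S (S … (S 0))`. -/
def numeral : ℕ → Term
  | 0 => zero
  | n + 1 => succ (numeral n)

/-- `I = λ x. x`. -/
def I : Term := lam (var 0)

/-- `snd = λ x. let x = ⟨a, b⟩ in rec ⟨a, 0⟩ b I I`. -/
def snd : Term := lam (letp (var 0) (recur (pair (var 1) zero) (var 0) I I))

/-- `C = λ x. rec ⟨x, 0⟩ ⟨0, 0⟩ (λ x. let x = ⟨a, b⟩ in ⟨S a, S b⟩) I`. -/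
def copy : Term :=
  lam (recur (pair (var 0) zero) (pair zero zero)
    (lam (letp (var 0) (pair (succ (var 1)) (succ (var 0))))) I)

/-- `F = λ x. let C (snd x) = ⟨y, z⟩ in ⟨f (S y), S z⟩`, for a closed term `f`
(which therefore needs no renaming under the binders). -/
def minStep (f : Term) : Term :=
  lam (letp (app copy (app snd (var 0))) (pair (app f (succ (var 1))) (succ (var 0))))

/-- `M = rec ⟨f 0, 0⟩ 0 (λ x. S x) F`, for a closed term `f`. -/
def minTerm (f : Term) : Term :=
  recur (pair (app f zero) zero) zero (lam (succ (var 0))) (minStep f)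

/-- The closed term `t` of the calculus represents the total function `f`. -/
def Represents (t : Term) (f : ℕ → ℕ) : Prop :=
  Linear t ∧ Closed t ∧ ∀ n, Red (app t (numeral n)) (numeral (f n))

/-- `t n₁ … n_k`. -/
def appNumerals (t : Term) (l : List ℕ) : Term := l.foldl (fun s n => app s (numeral n)) t

end Term

/-- Linear types: `nat`, `A ⊸ B`, `A ⊗ B`. -/
inductive Ty : Type
  | nat : Ty
  | lolli : Ty → Ty → Ty
  | tensor : Ty → Ty → Ty

/-- A type environment assigns types to some of the variables. As environments are not ordered,
the exchange rule is built in. -/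
abbrev Env : Type := ℕ → Option Ty

namespace Env

def empty : Env := fun _ => none

def single (i : ℕ) (A : Ty) : Env := fun j => if j = i then some A else none

/-- `Γ, x : A`, where `x` gets index `0`. -/
def extend (Γ : Env) (A : Ty) : Env
  | 0 => some A
  | n + 1 => Γ n

/-- `Γ` is the disjoint union of `Γ₁` and `Γ₂`. -/
def Split (Γ Γ₁ Γ₂ : Env) : Prop :=
  ∀ i, (Γ₁ i = Γ i ∧ Γ₂ i = none) ∨ (Γ₁ i = none ∧ Γ₂ i = Γ i)

end Env

open Term in
/-- The linear type system: `HasType Γ t A` is `Γ ⊢ t : A`. -/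
inductive HasType : Env → Term → Ty → Prop
  | var (i : ℕ) (A : Ty) : HasType (Env.single i A) (var i) A
  | lam {Γ : Env} {t : Term} {A B : Ty} :
      HasType (Γ.extend A) t B → HasType Γ (lam t) (Ty.lolli A B)
  | app {Γ Γ₁ Γ₂ : Env} {t u : Term} {A B : Ty} : Env.Split Γ Γ₁ Γ₂ →
      HasType Γ₁ t (Ty.lolli A B) → HasType Γ₂ u A → HasType Γ (app t u) B
  | pair {Γ Γ₁ Γ₂ : Env} {t u : Term} {A B : Ty} : Env.Split Γ Γ₁ Γ₂ →
      HasType Γ₁ t A → HasType Γ₂ u B → HasType Γ (pair t u) (Ty.tensor A B)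
  | letp {Γ Γ₁ Γ₂ : Env} {t u : Term} {A B C : Ty} : Env.Split Γ Γ₁ Γ₂ →
      HasType Γ₁ t (Ty.tensor A B) → HasType ((Γ₂.extend A).extend B) u C →
      HasType Γ (letp t u) C
  | zero : HasType Env.empty zero Ty.nat
  | succ {Γ : Env} {t : Term} : HasType Γ t Ty.nat → HasType Γ (succ t) Ty.nat
  | recur {Γ Γ₁ Γ₂ Γ₃ Γ₄ Γ₃₄ Γ₂₃₄ : Env} {t u v w : Term} {A : Ty} :
      Env.Split Γ Γ₁ Γ₂₃₄ → Env.Split Γ₂₃₄ Γ₂ Γ₃₄ → Env.Split Γ₃₄ Γ₃ Γ₄ →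
      HasType Γ₁ t (Ty.tensor Ty.nat Ty.nat) → HasType Γ₂ u A →
      HasType Γ₃ v (Ty.lolli A A) →
      HasType Γ₄ w (Ty.lolli (Ty.tensor Ty.nat Ty.nat) (Ty.tensor Ty.nat Ty.nat)) →
      HasType Γ (recur t u v w) A

/-- The type `nat ⊸ (nat ⊸ … ⊸ nat)` of functions with `k` arguments. -/
def natFun : ℕ → Ty
  | 0 => Ty.nat
  | k + 1 => Ty.lolli Ty.nat (natFun k)

/-- The closed, typed term `t` defines the partial function `h`: applied to the numerals of the
arguments it reduces to the numeral of the value if there is one, and diverges otherwise. -/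
def Defines {k : ℕ} (t : Term) (h : List.Vector ℕ k →. ℕ) : Prop :=
  t.Linear ∧ t.Closed ∧ HasType Env.empty t (natFun k) ∧
    ∀ x : List.Vector ℕ k,
      (∀ m ∈ h x, (t.appNumerals x.toList).Red (Term.numeral m)) ∧
      (¬ (h x).Dom → (t.appNumerals x.toList).Diverges)

end Lrec

/-!
The search loop `minTerm f` reduces, as long as `f 0, …, f (k - 1)` are non-zero, to `k` successors
in front of the loop in its `k`-th state (`red_minTerm_iterate`). At the first zero of `f` the loop
stops and leaves a numeral. If there is no zero, the loop produces arbitrarily many successors.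
Closed reduction is confluent (`Red.confluent`, by parallel reduction; only closed terms are ever
substituted, so substitutions commute without renaming), hence a normal form of `minTerm f` would
begin with arbitrarily many successors, which is absurd (`diverges_of_forall_iterate_succ`).

For Turing completeness, functions of `k` arguments are first computed by combinators on tuples of
numerals, nested pairs which a linear combinator can copy (`dup`) and erase (`erase`); at the end
they are curried. The predicate `Computes` is proved by induction on the definition of the partial
recursive functions. Primitive recursion iterates a state of type `ℕ ⊗ (ℕ ⊗ ℕᵏ)`. Minimisation with
parameters `x` reduces to `minTerm (λ y. f ⟨y, x⟩)`. Composition has to diverge whenever one of the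
inner functions does, even if the outer one ignores its value: copies of all inner terms are
therefore evaluated and erased first by `rec ⟨a, 0⟩ r I I`, and this term diverges with `a`, because
its reducts form an explicit set of terms that are never normal (`Diverges.discard`). Confluence
also shows that a term diverges if one of its reducts does (`Diverges.of_red`).

Linear typing is obtained from simple typing in a shared context together with syntactic linearity
(`STyped.hasType`).
-/

namespace Lrec
namespace Term

/-! ### Closed terms and substitution -/

theorem lift_eq_self {t : Term} : ∀ {c : ℕ}, (∀ k, c ≤ k → ¬ Free k t) → lift c t = t := by
  induction t with
  | var i =>
    intro c h
    have : i < c := by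
      by_contra hc
      exact h i (by omega) rfl
    simp [lift, this]
  | zero => intros; rfl
  | succ t ih => intro c h; simp only [Free] at h; simp [lift, ih h]
  | recur t u v w iht ihu ihv ihw =>
    intro c h
    simp only [Free, not_or] at h
    simp [lift, iht fun k hk => (h k hk).1, ihu fun k hk => (h k hk).2.1,
      ihv fun k hk => (h k hk).2.2.1, ihw fun k hk => (h k hk).2.2.2]
  | app t u iht ihu =>
    intro c h
    simp only [Free, not_or] at h
    simp [lift, iht fun k hk => (h k hk).1, ihu fun k hk => (h k hk).2]
  | lam t ih =>
    intro c h
    simp only [Free] at h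
    rw [lift, ih]
    intro k hk
    obtain ⟨k, rfl⟩ : ∃ j, k = j + 1 := ⟨k - 1, by omega⟩
    exact h k (by omega)
  | pair t u iht ihu =>
    intro c h
    simp only [Free, not_or] at h
    simp [lift, iht fun k hk => (h k hk).1, ihu fun k hk => (h k hk).2]
  | letp t u iht ihu =>
    intro c h
    simp only [Free, not_or] at h
    rw [lift, iht fun k hk => (h k hk).1, ihu]
    intro k hk
    obtain ⟨k, rfl⟩ : ∃ j, k = j + 2 := ⟨k - 2, by omega⟩
    exact (h k (by omega)).2

theorem subst_eq_self {t : Term} :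
    ∀ {c : ℕ} {s : Term}, (∀ k, c ≤ k → ¬ Free k t) → subst c s t = t := by
  induction t with
  | var i =>
    intro c s h
    have : i < c := by
      by_contra hc
      exact h i (by omega) rfl
    simp [subst, this]
  | zero => intros; rfl
  | succ t ih => intro c s h; simp only [Free] at h; simp [subst, ih h]
  | recur t u v w iht ihu ihv ihw =>
    intro c s h
    simp only [Free, not_or] at h
    simp [subst, iht fun k hk => (h k hk).1, ihu fun k hk => (h k hk).2.1,
      ihv fun k hk => (h k hk).2.2.1, ihw fun k hk => (h k hk).2.2.2]
  | app t u iht ihu =>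
    intro c s h
    simp only [Free, not_or] at h
    simp [subst, iht fun k hk => (h k hk).1, ihu fun k hk => (h k hk).2]
  | lam t ih =>
    intro c s h
    simp only [Free] at h
    rw [subst, ih]
    intro k hk
    obtain ⟨k, rfl⟩ : ∃ j, k = j + 1 := ⟨k - 1, by omega⟩
    exact h k (by omega)
  | pair t u iht ihu =>
    intro c s h
    simp only [Free, not_or] at h
    simp [subst, iht fun k hk => (h k hk).1, ihu fun k hk => (h k hk).2]
  | letp t u iht ihu =>
    intro c s h
    simp only [Free, not_or] at h
    rw [subst, iht fun k hk => (h k hk).1, ihu]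
    intro k hk
    obtain ⟨k, rfl⟩ : ∃ j, k = j + 2 := ⟨k - 2, by omega⟩
    exact (h k (by omega)).2

theorem Closed.lift_eq {t : Term} (h : Closed t) (c : ℕ) : lift c t = t :=
  lift_eq_self fun k _ => h k

theorem Closed.subst_eq {t : Term} (h : Closed t) (c : ℕ) (s : Term) : subst c s t = t :=
  subst_eq_self fun k _ => h k

theorem Closed.free_iff {t : Term} (h : Closed t) (k : ℕ) : Free k t ↔ False :=
  iff_false_intro (h k)

theorem free_subst {s : Term} (hs : Closed s) {t : Term} :
    ∀ {j k : ℕ}, Free k (subst j s t) ↔ Free (if k < j then k else k + 1) t := by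
  induction t with
  | var i =>
    intro j k
    simp only [subst]
    rcases lt_trichotomy i j with h | h | h
    · simp only [h, if_true, Free]
      split <;> omega
    · subst h
      simp only [lt_irrefl, if_false, if_true, hs.free_iff, Free, false_iff]
      split <;> omega
    · simp only [h.not_gt, h.ne', if_false, Free]
      split <;> omega
  | zero => intros; simp [subst, Free]
  | succ t ih => intros; simp [subst, Free, ih]
  | recur t u v w iht ihu ihv ihw => intros; simp [subst, Free, iht, ihu, ihv, ihw]
  | app t u iht ihu => intros; simp [subst, Free, iht, ihu]
  | lam t ih =>
    intro j k
    simp only [subst, Free, hs.lift_eq, ih, Nat.add_lt_add_iff_right]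
    split <;> rfl
  | pair t u iht ihu => intros; simp [subst, Free, iht, ihu]
  | letp t u iht ihu =>
    intro j k
    simp only [subst, Free, hs.lift_eq, iht, ihu, Nat.add_lt_add_iff_right]
    split <;> rfl

/-- Substitutions of closed terms commute. -/
theorem subst_subst_of_closed {s v : Term} (hs : Closed s) (hv : Closed v) {t : Term} :
    ∀ {j k : ℕ}, j ≤ k → subst k s (subst j v t) = subst j v (subst (k + 1) s t) := by
  induction t with
  | var i =>
    intro j k hjk
    simp only [subst]
    rcases lt_trichotomy i j with h | h | h
    · simp [h, subst, show i < k by omega, show i < k + 1 by omega]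
    · subst h
      simp [subst, hv.subst_eq, show i < k + 1 by omega]
    · rcases lt_trichotomy i (k + 1) with h' | h' | h'
      · simp [subst, h.not_gt, h.ne', h', show i - 1 < k by omega]
      · subst h'
        simp [subst, h.not_gt, h.ne', hs.subst_eq]
      · simp [subst, h.not_gt, h.ne', h'.not_gt, h'.ne', show ¬ i - 1 < k by omega,
          show ¬ i - 1 = k by omega, show ¬ i - 1 < j by omega, show ¬ i - 1 = j by omega]
  | zero => intros; rfl
  | succ t ih => intro j k h; simp [subst, ih h]
  | recur t u v w iht ihu ihv ihw => intro j k h; simp [subst, iht h, ihu h, ihv h, ihw h]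
  | app t u iht ihu => intro j k h; simp [subst, iht h, ihu h]
  | lam t ih => intro j k h; simp [subst, hs.lift_eq, hv.lift_eq, ih (Nat.succ_le_succ h)]
  | pair t u iht ihu => intro j k h; simp [subst, iht h, ihu h]
  | letp t u iht ihu =>
    intro j k h
    simp [subst, hs.lift_eq, hv.lift_eq, iht h, ihu (Nat.add_le_add_right h 2)]

/-! ### Confluence -/

/-- Parallel closed reduction: any set of redexes of the term is contracted at once. -/
inductive Par : Term → Term → Prop
  | var (i : ℕ) : Par (var i) (var i)
  | zero : Par zero zero
  | succ {t t' : Term} : Par t t' → Par (succ t) (succ t')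
  | recur {t t' u u' v v' w w' : Term} : Par t t' → Par u u' → Par v v' → Par w w' →
      Par (recur t u v w) (recur t' u' v' w')
  | app {t t' u u' : Term} : Par t t' → Par u u' → Par (app t u) (app t' u')
  | lam {t t' : Term} : Par t t' → Par (lam t) (lam t')
  | pair {t t' u u' : Term} : Par t t' → Par u u' → Par (pair t u) (pair t' u')
  | letp {t t' u u' : Term} : Par t t' → Par u u' → Par (letp t u) (letp t' u')
  | beta {t t' v v' : Term} : Closed v → Par t t' → Par v v' →
      Par (Term.app (Term.lam t) v) (subst 0 v' t')
  | letp_pair {t t' u u' v v' : Term} : Closed t → Closed u → Par t t' → Par u u' → Par v v' →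
      Par (Term.letp (Term.pair t u) v) (subst 0 u' (subst 1 (lift 0 t') v'))
  | rec_zero {s u u' v w : Term} : Closed s → Closed v → Closed w → Par u u' →
      Par (Term.recur (Term.pair Term.zero s) u v w) u'
  | rec_succ {t t' s s' u u' v v' w w' : Term} : Closed v → Closed w →
      Par t t' → Par s s' → Par u u' → Par v v' → Par w w' →
      Par (Term.recur (Term.pair (Term.succ t) s) u v w)
        (Term.app v' (Term.recur (Term.app w' (Term.pair t' s')) u' v' w'))

theorem Par.refl : ∀ t : Term, Par t t
  | .var i => .var i
  | .zero => .zero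
  | .succ t => .succ (refl t)
  | .recur t u v w => .recur (refl t) (refl u) (refl v) (refl w)
  | .app t u => .app (refl t) (refl u)
  | .lam t => .lam (refl t)
  | .pair t u => .pair (refl t) (refl u)
  | .letp t u => .letp (refl t) (refl u)

theorem Step.par {t t' : Term} (h : Step t t') : Par t t' := by
  induction h with
  | beta h => exact .beta h (.refl _) (.refl _)
  | letp_pair h h' => exact .letp_pair h h' (.refl _) (.refl _) (.refl _)
  | rec_zero h h' h'' => exact .rec_zero h h' h'' (.refl _)
  | rec_succ h h' => exact .rec_succ h h' (.refl _) (.refl _) (.refl _) (.refl _) (.refl _)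
  | succ _ ih => exact .succ ih
  | rec₁ _ ih => exact .recur ih (.refl _) (.refl _) (.refl _)
  | rec₂ _ ih => exact .recur (.refl _) ih (.refl _) (.refl _)
  | rec₃ _ ih => exact .recur (.refl _) (.refl _) ih (.refl _)
  | rec₄ _ ih => exact .recur (.refl _) (.refl _) (.refl _) ih
  | app₁ _ ih => exact .app ih (.refl _)
  | app₂ _ ih => exact .app (.refl _) ih
  | lam _ ih => exact .lam ih
  | pair₁ _ ih => exact .pair ih (.refl _)
  | pair₂ _ ih => exact .pair (.refl _) ih
  | letp₁ _ ih => exact .letp ih (.refl _)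
  | letp₂ _ ih => exact .letp (.refl _) ih

theorem Red.refl (t : Term) : Red t t := Relation.ReflTransGen.refl

theorem Red.trans {t u v : Term} (h : Red t u) (h' : Red u v) : Red t v :=
  Relation.ReflTransGen.trans h h'

theorem Step.red {t u : Term} (h : Step t u) : Red t u := Relation.ReflTransGen.single h

theorem Red.succ {t t' : Term} (h : Red t t') : Red (succ t) (succ t') :=
  Relation.ReflTransGen.lift Term.succ (fun _ _ => Step.succ) _ _ h

theorem Red.lam {t t' : Term} (h : Red t t') : Red (lam t) (lam t') :=
  Relation.ReflTransGen.lift Term.lam (fun _ _ => Step.lam) _ _ h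

theorem Red.app {t t' u u' : Term} (h : Red t t') (h' : Red u u') : Red (app t u) (app t' u') :=
  (Relation.ReflTransGen.lift (Term.app · u) (fun _ _ => Step.app₁) _ _ h).trans
    (Relation.ReflTransGen.lift (Term.app t' ·) (fun _ _ => Step.app₂) _ _ h')

theorem Red.pair {t t' u u' : Term} (h : Red t t') (h' : Red u u') :
    Red (pair t u) (pair t' u') :=
  (Relation.ReflTransGen.lift (Term.pair · u) (fun _ _ => Step.pair₁) _ _ h).trans
    (Relation.ReflTransGen.lift (Term.pair t' ·) (fun _ _ => Step.pair₂) _ _ h')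

theorem Red.letp {t t' u u' : Term} (h : Red t t') (h' : Red u u') :
    Red (letp t u) (letp t' u') :=
  (Relation.ReflTransGen.lift (Term.letp · u) (fun _ _ => Step.letp₁) _ _ h).trans
    (Relation.ReflTransGen.lift (Term.letp t' ·) (fun _ _ => Step.letp₂) _ _ h')

theorem Red.recur {t t' u u' v v' w w' : Term} (ht : Red t t') (hu : Red u u') (hv : Red v v')
    (hw : Red w w') : Red (recur t u v w) (recur t' u' v' w') :=
  (Relation.ReflTransGen.lift (Term.recur · u v w) (fun _ _ => Step.rec₁) _ _ ht).trans <|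
  (Relation.ReflTransGen.lift (Term.recur t' · v w) (fun _ _ => Step.rec₂) _ _ hu).trans <|
  (Relation.ReflTransGen.lift (Term.recur t' u' · w) (fun _ _ => Step.rec₃) _ _ hv).trans
    (Relation.ReflTransGen.lift (Term.recur t' u' v' ·) (fun _ _ => Step.rec₄) _ _ hw)

/-- No reduction rule creates a free variable, since only closed terms are substituted. -/
theorem Par.free {t t' : Term} (h : Par t t') : ∀ {k : ℕ}, Free k t' → Free k t := by
  induction h with
  | var | zero => exact id
  | succ _ ih => exact ih
  | recur _ _ _ _ iht ihu ihv ihw =>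
    intro k
    exact Or.imp iht (Or.imp ihu (Or.imp ihv ihw))
  | app _ _ iht ihu | pair _ _ iht ihu =>
    intro k
    exact Or.imp iht ihu
  | lam _ ih => exact ih
  | letp _ _ iht ihu =>
    intro k
    exact Or.imp iht ihu
  | beta hv _ _ iht ihv =>
    intro k hk
    rw [free_subst fun j hj => hv j (ihv hj)] at hk
    exact Or.inl (iht hk)
  | letp_pair ht hu _ _ _ iht ihu ihv =>
    intro k hk
    have ht' : Closed _ := fun j hj => ht j (iht hj)
    rw [ht'.lift_eq, free_subst fun j hj => hu j (ihu hj), free_subst ht'] at hk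
    exact Or.inr (ihv hk)
  | rec_zero _ _ _ _ ih =>
    intro k hk
    exact Or.inr (Or.inl (ih hk))
  | rec_succ _ _ _ _ _ _ _ iht ihs ihu ihv ihw =>
    intro k hk
    rcases hk with hk | (hk | hk | hk) | hk | hk | hk
    · exact .inr (.inr (.inl (ihv hk)))
    · exact .inr (.inr (.inr (ihw hk)))
    · exact .inl (.inl (iht hk))
    · exact .inl (.inr (ihs hk))
    · exact .inr (.inl (ihu hk))
    · exact .inr (.inr (.inl (ihv hk)))
    · exact .inr (.inr (.inr (ihw hk)))

theorem Par.closed {t t' : Term} (h : Par t t') (ht : Closed t) : Closed t' :=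
  fun k hk => ht k (h.free hk)

theorem Red.closed {t t' : Term} (h : Red t t') (ht : Closed t) : Closed t' := by
  induction h with
  | refl => exact ht
  | tail _ h ih => exact h.par.closed ih

theorem Par.red {t t' : Term} (h : Par t t') : Red t t' := by
  induction h with
  | var | zero => exact .refl _
  | succ _ ih => exact ih.succ
  | recur _ _ _ _ iht ihu ihv ihw => exact iht.recur ihu ihv ihw
  | app _ _ iht ihu => exact iht.app ihu
  | lam _ ih => exact ih.lam
  | pair _ _ iht ihu => exact iht.pair ihu
  | letp _ _ iht ihu => exact iht.letp ihu
  | beta hv _ hp iht ihv => exact (iht.lam.app ihv).trans (Step.beta (hp.closed hv)).red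
  | letp_pair ht hu hpt hpu _ iht ihu ihv =>
    exact ((iht.pair ihu).letp ihv).trans (Step.letp_pair (hpt.closed ht) (hpu.closed hu)).red
  | rec_zero hs hv hw _ ih => exact (Step.rec_zero hs hv hw).red.trans ih
  | rec_succ hv hw _ _ _ hpv hpw iht ihs ihu ihv ihw =>
    exact ((iht.succ.pair ihs).recur ihu ihv ihw).trans
      (Step.rec_succ (hpv.closed hv) (hpw.closed hw)).red

/-- Only closed terms need to be substituted, so the side conditions of the rules are unaffected. -/
theorem Par.subst {s s' : Term} (hs : Closed s) (hss : Par s s') {t t' : Term} (h : Par t t') :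
    ∀ {k : ℕ}, Par (subst k s t) (subst k s' t') := by
  have hs' := hss.closed hs
  induction h with
  | var i =>
    intro k
    simp only [Term.subst]
    split
    · exact .var _
    · split
      · exact hss
      · exact .var _
  | zero => intro; exact .zero
  | succ _ ih => intro; exact .succ ih
  | recur _ _ _ _ iht ihu ihv ihw => intro; exact .recur iht ihu ihv ihw
  | app _ _ iht ihu => intro; exact .app iht ihu
  | lam _ ih =>
    intro
    simp only [Term.subst, hs.lift_eq, hs'.lift_eq]
    exact .lam ih
  | pair _ _ iht ihu => intro; exact .pair iht ihu
  | letp _ _ iht ihu =>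
    intro
    simp only [Term.subst, hs.lift_eq, hs'.lift_eq]
    exact .letp iht ihu
  | beta hv _ hp iht _ =>
    intro k
    rw [subst_subst_of_closed hs' (hp.closed hv) k.zero_le]
    simp only [Term.subst, hs.lift_eq, hv.subst_eq]
    exact .beta hv iht hp
  | letp_pair ht hu hpt hpu _ _ _ ihv =>
    intro k
    have ht' := hpt.closed ht
    have key := Par.letp_pair ht hu hpt hpu (@ihv (k + 2))
    rw [ht'.lift_eq] at key ⊢
    rw [subst_subst_of_closed hs' (hpu.closed hu) k.zero_le,
      subst_subst_of_closed hs' ht' (Nat.succ_le_succ k.zero_le)]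
    simpa only [Term.subst, hs.lift_eq, ht.subst_eq, hu.subst_eq] using key
  | rec_zero ht hv hw _ ih =>
    intro k
    simp only [Term.subst, ht.subst_eq, hv.subst_eq, hw.subst_eq]
    exact .rec_zero ht hv hw ih
  | rec_succ hv hw _ _ _ hpv hpw iht ihs ihu ihv ihw =>
    intro k
    simp only [Term.subst, hv.subst_eq, hw.subst_eq, (hpv.closed hv).subst_eq,
      (hpw.closed hw).subst_eq]
    exact .rec_succ hv hw iht ihs ihu hpv hpw

/-- The diamond property. The left-hand sides of the rules do not overlap, and reduction keeps
closed terms closed, so a redex survives all other contractions. -/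
theorem Par.diamond {t a : Term} (h : Par t a) :
    ∀ {b : Term}, Par t b → ∃ c, Par a c ∧ Par b c := by
  induction h with
  | var i => intro b hb; exact ⟨b, hb, .refl b⟩
  | zero => intro b hb; exact ⟨b, hb, .refl b⟩
  | succ _ ih =>
    intro b hb
    cases hb with
    | succ hb =>
      obtain ⟨c, h1, h2⟩ := ih hb
      exact ⟨_, .succ h1, .succ h2⟩
  | lam _ ih =>
    intro b hb
    cases hb with
    | lam hb =>
      obtain ⟨c, h1, h2⟩ := ih hb
      exact ⟨_, .lam h1, .lam h2⟩
  | pair _ _ iht ihu =>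
    intro b hb
    cases hb with
    | pair ht hu =>
      obtain ⟨c, h1, h2⟩ := iht ht
      obtain ⟨d, h3, h4⟩ := ihu hu
      exact ⟨_, .pair h1 h3, .pair h2 h4⟩
  | app hpt hpu iht ihu =>
    intro b hb
    cases hb with
    | app ht hu =>
      obtain ⟨c, h1, h2⟩ := iht ht
      obtain ⟨d, h3, h4⟩ := ihu hu
      exact ⟨_, .app h1 h3, .app h2 h4⟩
    | beta hv ht hu =>
      obtain ⟨c, h1, h2⟩ := iht (.lam ht)
      obtain ⟨d, h3, h4⟩ := ihu hu
      cases hpt with | lam _ =>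
      cases h1 with | lam h1 =>
      cases h2 with | lam h2 =>
      exact ⟨_, .beta (hpu.closed hv) h1 h3, .subst (hu.closed hv) h4 h2⟩
  | beta hv hpt hpv iht ihv =>
    intro b hb
    cases hb with
    | app ht hu =>
      cases ht with | lam ht =>
      obtain ⟨c, h1, h2⟩ := iht ht
      obtain ⟨d, h3, h4⟩ := ihv hu
      exact ⟨_, .subst (hpv.closed hv) h3 h1, .beta (hu.closed hv) h2 h4⟩
    | beta _ ht hu =>
      obtain ⟨c, h1, h2⟩ := iht ht
      obtain ⟨d, h3, h4⟩ := ihv hu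
      exact ⟨_, .subst (hpv.closed hv) h3 h1, .subst (hu.closed hv) h4 h2⟩
  | letp hpt hpu iht ihu =>
    intro b hb
    cases hb with
    | letp ht hu =>
      obtain ⟨c, h1, h2⟩ := iht ht
      obtain ⟨d, h3, h4⟩ := ihu hu
      exact ⟨_, .letp h1 h3, .letp h2 h4⟩
    | letp_pair hct hcs ht hs hu =>
      obtain ⟨c, h1, h2⟩ := iht (.pair ht hs)
      obtain ⟨d, h3, h4⟩ := ihu hu
      cases hpt with | pair hpt hps =>
      cases h1 with | pair h1 h1' =>
      cases h2 with | pair h2 h2' =>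
      refine ⟨_, .letp_pair (hpt.closed hct) (hps.closed hcs) h1 h1' h3, ?_⟩
      rw [(ht.closed hct).lift_eq, (h2.closed (ht.closed hct)).lift_eq]
      exact .subst (hs.closed hcs) h2' (.subst (ht.closed hct) h2 h4)
  | letp_pair hct hcs hpt hps hpu iht ihs ihu =>
    intro b hb
    cases hb with
    | letp ht hu =>
      cases ht with | pair ht hs =>
      obtain ⟨c, h1, h2⟩ := iht ht
      obtain ⟨c', h1', h2'⟩ := ihs hs
      obtain ⟨d, h3, h4⟩ := ihu hu
      refine ⟨_, ?_, .letp_pair (ht.closed hct) (hs.closed hcs) h2 h2' h4⟩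
      rw [(hpt.closed hct).lift_eq, (h1.closed (hpt.closed hct)).lift_eq]
      exact .subst (hps.closed hcs) h1' (.subst (hpt.closed hct) h1 h3)
    | letp_pair _ _ ht hs hu =>
      obtain ⟨c, h1, h2⟩ := iht ht
      obtain ⟨c', h1', h2'⟩ := ihs hs
      obtain ⟨d, h3, h4⟩ := ihu hu
      rw [(hpt.closed hct).lift_eq, (ht.closed hct).lift_eq]
      exact ⟨_, .subst (hps.closed hcs) h1' (.subst (hpt.closed hct) h1 h3),
        .subst (hs.closed hcs) h2' (.subst (ht.closed hct) h2 h4)⟩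
  | recur hpt hpu hpv hpw iht ihu ihv ihw =>
    intro b hb
    cases hb with
    | recur ht hu hv hw =>
      obtain ⟨t₁, h1, h1'⟩ := iht ht
      obtain ⟨u₁, h2, h2'⟩ := ihu hu
      obtain ⟨v₁, h3, h3'⟩ := ihv hv
      obtain ⟨w₁, h4, h4'⟩ := ihw hw
      exact ⟨_, .recur h1 h2 h3 h4, .recur h1' h2' h3' h4'⟩
    | rec_zero hs hv hw hu =>
      obtain ⟨u₁, h2, h2'⟩ := ihu hu
      cases hpt with | pair hz hps =>
      cases hz
      exact ⟨_, .rec_zero (hps.closed hs) (hpv.closed hv) (hpw.closed hw) h2, h2'⟩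
    | rec_succ hcv hcw ht hs hu hv hw =>
      obtain ⟨t₁, h1, h1'⟩ := iht (.pair (.succ ht) hs)
      obtain ⟨u₁, h2, h2'⟩ := ihu hu
      obtain ⟨v₁, h3, h3'⟩ := ihv hv
      obtain ⟨w₁, h4, h4'⟩ := ihw hw
      cases hpt with | pair hpt hps =>
      cases hpt
      cases h1 with | pair h1 h5 =>
      cases h1 with | succ h1 =>
      cases h1' with | pair h1' h5' =>
      cases h1' with | succ h1' =>
      exact ⟨_, .rec_succ (hpv.closed hcv) (hpw.closed hcw) h1 h5 h2 h3 h4,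
        .app h3' (.recur (.app h4' (.pair h1' h5')) h2' h3' h4')⟩
  | rec_zero hcs hcv hcw hpu ihu =>
    intro b hb
    cases hb with
    | recur ht hu hv hw =>
      obtain ⟨u₁, h2, h2'⟩ := ihu hu
      cases ht with | pair hz hs =>
      cases hz
      exact ⟨_, h2, .rec_zero (hs.closed hcs) (hv.closed hcv) (hw.closed hcw) h2'⟩
    | rec_zero _ _ _ hu => exact ihu hu
  | rec_succ hcv hcw hpt hps hpu hpv hpw iht ihs ihu ihv ihw =>
    intro b hb
    cases hb with
    | recur ht hu hv hw =>
      cases ht with | pair ht hs =>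
      cases ht with | succ ht =>
      obtain ⟨t₁, h1, h1'⟩ := iht ht
      obtain ⟨s₁, h5, h5'⟩ := ihs hs
      obtain ⟨u₁, h2, h2'⟩ := ihu hu
      obtain ⟨v₁, h3, h3'⟩ := ihv hv
      obtain ⟨w₁, h4, h4'⟩ := ihw hw
      exact ⟨_, .app h3 (.recur (.app h4 (.pair h1 h5)) h2 h3 h4),
        .rec_succ (hv.closed hcv) (hw.closed hcw) h1' h5' h2' h3' h4'⟩
    | rec_succ _ _ ht hs hu hv hw =>
      obtain ⟨t₁, h1, h1'⟩ := iht ht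
      obtain ⟨s₁, h5, h5'⟩ := ihs hs
      obtain ⟨u₁, h2, h2'⟩ := ihu hu
      obtain ⟨v₁, h3, h3'⟩ := ihv hv
      obtain ⟨w₁, h4, h4'⟩ := ihw hw
      exact ⟨_, .app h3 (.recur (.app h4 (.pair h1 h5)) h2 h3 h4),
        .app h3' (.recur (.app h4' (.pair h1' h5')) h2' h3' h4')⟩

theorem red_iff_reflTransGen_par {t u : Term} : Red t u ↔ Relation.ReflTransGen Par t u := by
  refine ⟨fun h => Relation.ReflTransGen.mono (fun _ _ => Step.par) _ _ h, fun h => ?_⟩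
  induction h with
  | refl => exact .refl _
  | tail _ h ih => exact ih.trans h.red

theorem Red.confluent {t a b : Term} (ha : Red t a) (hb : Red t b) : ∃ c, Red a c ∧ Red b c := by
  obtain ⟨c, h1, h2⟩ := Relation.church_rosser
    (fun a b c hab hac => by
      obtain ⟨d, h, h'⟩ := Par.diamond hab hac
      exact ⟨d, .single h, .single h'⟩)
    (red_iff_reflTransGen_par.1 ha) (red_iff_reflTransGen_par.1 hb)
  exact ⟨c, red_iff_reflTransGen_par.2 h1, red_iff_reflTransGen_par.2 h2⟩

theorem IsNormal.eq_of_red {n t : Term} (hn : IsNormal n) (h : Red n t) : t = n := by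
  cases Relation.ReflTransGen.cases_head h with
  | inl h => exact h.symm
  | inr h => obtain ⟨u, hu, _⟩ := h; exact (hn u hu).elim

/-- By confluence, every reduct of a term with normal form `n` still reduces to `n`. -/
theorem Red.to_normal {t u n : Term} (h : Red t u) (hn : Red t n) (hnf : IsNormal n) :
    Red u n := by
  obtain ⟨c, h1, h2⟩ := h.confluent hn
  exact hnf.eq_of_red h2 ▸ h1

theorem Diverges.of_red {t u : Term} (h : Red t u) (hu : Diverges u) : Diverges t :=
  fun ⟨n, hn, hnf⟩ => hu ⟨n, h.to_normal hn hnf, hnf⟩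

theorem Diverges.step {t u : Term} (h : Step t u) (ht : Diverges t) : Diverges u :=
  fun ⟨n, hn, hnf⟩ => ht ⟨n, h.red.trans hn, hnf⟩

/-! ### Evaluation of the basic combinators -/

theorem closed_numeral : ∀ n, Closed (numeral n)
  | 0 => fun _ h => h
  | n + 1 => closed_numeral n

theorem closed_zero : Closed zero := fun _ h => h

theorem closed_I : Closed I := fun _ h => Nat.succ_ne_zero _ (Eq.symm h)

theorem closed_snd : Closed snd := by intro k; simp [snd, Free, closed_I.free_iff]

theorem closed_copy : Closed copy := by intro k; simp [copy, Free, closed_I.free_iff]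

theorem closed_lam_succ : Closed (lam (succ (var 0))) := by intro k; simp [Free]

theorem Closed.app {t u : Term} (ht : Closed t) (hu : Closed u) : Closed (app t u) :=
  fun k h => h.elim (ht k) (hu k)

theorem Closed.pair {t u : Term} (ht : Closed t) (hu : Closed u) : Closed (pair t u) :=
  fun k h => h.elim (ht k) (hu k)

theorem Closed.recur {t u v w : Term} (ht : Closed t) (hu : Closed u) (hv : Closed v)
    (hw : Closed w) : Closed (recur t u v w) :=
  fun k h => h.elim (ht k) fun h => h.elim (hu k) fun h => h.elim (hv k) (hw k)

theorem red_beta {t v r : Term} (hv : Closed v) (h : Red (subst 0 v t) r) :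
    Red (app (lam t) v) r :=
  (Step.beta hv).red.trans h

theorem red_letp {p a b t r : Term} (hp : Red p (pair a b)) (ha : Closed a) (hb : Closed b)
    (h : Red (subst 0 b (subst 1 a t)) r) : Red (letp p t) r := by
  have := (Step.letp_pair (v := t) ha hb).red
  rw [ha.lift_eq] at this
  exact (hp.letp (.refl _)).trans (this.trans h)

theorem red_I {t : Term} (ht : Closed t) : Red (app I t) t := red_beta ht (.refl _)

/-- With `I` as its last argument, the recursor is the usual iterator. -/
theorem red_iterate {u v : Term} (hv : Closed v) {g : ℕ → Term} (h0 : Red u (g 0))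
    (hs : ∀ k, Red (app v (g k)) (g (k + 1))) :
    ∀ n, Red (recur (pair (numeral n) zero) u v I) (g n)
  | 0 => (Step.rec_zero closed_zero hv closed_I).red.trans h0
  | n + 1 => by
    refine (Step.rec_succ hv closed_I).red.trans (Red.trans (Red.app (.refl _) ?_) (hs n))
    exact (Red.recur (red_I ((closed_numeral n).pair closed_zero)) (.refl _) (.refl _)
      (.refl _)).trans (red_iterate hv h0 hs n)

/-- `rec ⟨a, 0⟩ r I I`: consumes the number `a`, then behaves as `r`. This is how the linear
calculus erases numbers. -/
def discard (a r : Term) : Term := recur (pair a zero) r I I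

theorem red_discard {a r : Term} {n : ℕ} (ha : Red a (numeral n)) (hr : Closed r) :
    Red (discard a r) r :=
  (Red.recur (ha.pair (.refl _)) (.refl _) (.refl _) (.refl _)).trans
    (red_iterate (g := fun _ => r) closed_I (.refl _) (fun _ => red_I hr) n)

theorem red_snd (n : ℕ) {b : Term} (hb : Closed b) : Red (app snd (pair (numeral n) b)) b := by
  have hn := closed_numeral n
  refine red_beta (hn.pair hb) ?_
  simp only [subst, lt_irrefl, if_true, if_false]
  refine red_letp (.refl _) hn hb ?_
  have : Red (discard (numeral n) b) b := red_discard (.refl _) hb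
  simpa [subst, discard, hn.subst_eq, closed_I.subst_eq] using this

theorem red_copy (n : ℕ) : Red (app copy (numeral n)) (pair (numeral n) (numeral n)) := by
  refine red_beta (closed_numeral n) ?_
  simp only [subst, lt_irrefl, if_true, closed_I.subst_eq, Nat.reduceAdd, Nat.reduceLT]
  refine red_iterate (g := fun k => pair (numeral k) (numeral k)) ?_ (.refl _) (fun k => ?_) n
  · intro k; simp [Free]
  · have hk := closed_numeral k
    refine red_beta (hk.pair hk) ?_
    simp only [subst, lt_irrefl, if_true, Nat.reduceAdd, Nat.reduceLT]
    refine red_letp (.refl _) hk hk ?_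
    simpa [subst, numeral, hk.subst_eq] using Red.refl (pair (numeral (k + 1)) (numeral (k + 1)))

/-! ### Divergence -/

theorem isNormal_I : IsNormal I := by
  intro u h
  cases h with | lam h => cases h

theorem isNormal_zero : IsNormal zero := fun _ h => nomatch h

theorem Diverges.exists_step {t : Term} (h : Diverges t) : ∃ t', Step t t' := by
  by_contra! hn
  exact h ⟨t, .refl t, hn⟩

theorem not_diverges_zero : ¬ Diverges zero := fun h => h ⟨zero, .refl _, isNormal_zero⟩

theorem Diverges.of_succ {t : Term} (h : Diverges (succ t)) : Diverges t := by
  rintro ⟨n, hn, hnf⟩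
  refine h ⟨_, hn.succ, ?_⟩
  intro u hu
  cases hu with | succ hu => exact hnf _ hu

/-- A set of terms that is closed under reduction and contains no normal form consists of
divergent terms. -/
theorem diverges_of_invariant (P : Term → Prop) (hstep : ∀ t t', P t → Step t t' → P t')
    (hex : ∀ t, P t → ∃ t', Step t t') {t : Term} (ht : P t) : Diverges t := by
  rintro ⟨n, hn, hnf⟩
  have hP : P n := by
    clear hnf
    induction hn with
    | refl => exact ht
    | tail _ h ih => exact hstep _ _ ih h
  obtain ⟨u, hu⟩ := hex n hP
  exact hnf u hu

/-- The terms `I (… (I ⟨r, 0⟩))` with `r` divergent. -/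
inductive StuckPair : Term → Prop
  | pair {r : Term} : Diverges r → StuckPair (pair r zero)
  | app {p : Term} : StuckPair p → StuckPair (app I p)

/-- The terms `I (… (I (rec p u I I)))` with `p` a `StuckPair`. These contain all reducts of
`discard r u` for a divergent `r`. -/
inductive StuckLoop : Term → Prop
  | recur {p u : Term} : StuckPair p → StuckLoop (recur p u I I)
  | app {t : Term} : StuckLoop t → StuckLoop (app I t)

theorem StuckPair.step {p p' : Term} (hp : StuckPair p) : Step p p' → StuckPair p' := by
  induction hp generalizing p' with
  | pair hr =>
    intro h
    cases h with
    | pair₁ h => exact .pair (hr.step h)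
    | pair₂ h => cases h
  | app hp ih =>
    intro h
    cases h with
    | beta _ => exact hp
    | app₁ h => exact (isNormal_I _ h).elim
    | app₂ h => exact .app (ih h)

theorem StuckPair.exists_step {p : Term} (hp : StuckPair p) : ∃ p', Step p p' := by
  induction hp with
  | pair hr => exact hr.exists_step.imp' _ fun _ => Step.pair₁
  | app _ ih => exact ih.imp' _ fun _ => Step.app₂

theorem StuckLoop.step {t t' : Term} (ht : StuckLoop t) : Step t t' → StuckLoop t' := by
  induction ht generalizing t' with
  | recur hp =>
    intro h
    cases h with
    | rec_zero _ _ _ => cases hp with | pair h => exact (not_diverges_zero h).elim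
    | rec_succ _ _ => cases hp with | pair h => exact .app (.recur (.app (.pair h.of_succ)))
    | rec₁ h => exact .recur (hp.step h)
    | rec₂ h => exact .recur hp
    | rec₃ h => exact (isNormal_I _ h).elim
    | rec₄ h => exact (isNormal_I _ h).elim
  | app ht ih =>
    intro h
    cases h with
    | beta _ => exact ht
    | app₁ h => exact (isNormal_I _ h).elim
    | app₂ h => exact .app (ih h)

theorem StuckLoop.exists_step {t : Term} (ht : StuckLoop t) : ∃ t', Step t t' := by
  induction ht with
  | recur hp => exact hp.exists_step.imp' _ fun _ => Step.rec₁
  | app _ ih => exact ih.imp' _ fun _ => Step.app₂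

/-- Erasure is strict: consuming a divergent term diverges, whatever comes afterwards. -/
theorem Diverges.discard {a : Term} (ha : Diverges a) (r : Term) : Diverges (discard a r) :=
  diverges_of_invariant StuckLoop (fun _ _ => StuckLoop.step) (fun _ => StuckLoop.exists_step)
    (.recur (.pair ha))

theorem exists_iterate_succ_of_red {t n : Term} :
    ∀ {k : ℕ}, Red (succ^[k] t) n → ∃ t', n = succ^[k] t' := by
  intro k h
  induction h with
  | refl => exact ⟨t, rfl⟩
  | tail _ h ih =>
    obtain ⟨t', rfl⟩ := ih
    clear * - h
    rename_i c
    induction k generalizing t' c with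
    | zero => exact ⟨_, rfl⟩
    | succ k ih =>
      simp only [Function.iterate_succ_apply'] at h ⊢
      cases h with | succ h =>
      obtain ⟨t'', rfl⟩ := ih _ h
      exact ⟨t'', rfl⟩

theorem le_sizeOf_iterate_succ (t : Term) (k : ℕ) : k ≤ sizeOf (succ^[k] t) := by
  induction k with
  | zero => exact Nat.zero_le _
  | succ k ih =>
    rw [Function.iterate_succ_apply']
    simp only [succ.sizeOf_spec]
    omega

/-- A term that produces arbitrarily many successors has no normal form: by confluence the normal
form would have to start with arbitrarily many successors as well. -/
theorem diverges_of_forall_iterate_succ {t : Term} (h : ∀ k, ∃ r, Red t (succ^[k] r)) :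
    Diverges t := by
  rintro ⟨n, hn, hnf⟩
  obtain ⟨r, hr⟩ := h (sizeOf n + 1)
  obtain ⟨r', h'⟩ := exists_iterate_succ_of_red (hr.to_normal hn hnf)
  have := le_sizeOf_iterate_succ r' (sizeOf n + 1)
  rw [← h'] at this
  omega

theorem numeral_eq_iterate (n : ℕ) : numeral n = succ^[n] zero := by
  induction n with
  | zero => rfl
  | succ n ih => rw [Function.iterate_succ_apply', ← ih]; rfl

/-! ### Minimisation -/

theorem closed_minStep {t : Term} (ht : Closed t) : Closed (minStep t) := by
  intro k
  simp [minStep, Free, ht.free_iff, closed_copy.free_iff, closed_snd.free_iff]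

theorem closed_minTerm {t : Term} (ht : Closed t) : Closed (minTerm t) := by
  intro k
  simp [minTerm, Free, ht.free_iff, (closed_minStep ht).free_iff]

theorem linear_minTerm {t : Term} (hl : Linear t) (ht : Closed t) : Linear (minTerm t) := by
  simp [minTerm, minStep, copy, snd, I, Linear, Apart, Free, hl, ht.free_iff]

/-- The state of the search loop `minTerm t` after `k` rounds. -/
def minLoop (f : ℕ → ℕ) (t : Term) (k : ℕ) : Term :=
  recur (pair (numeral (f k)) (numeral k)) zero (lam (succ (var 0))) (minStep t)

section Minimisation

variable {f : ℕ → ℕ} {t : Term}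

theorem red_minStep (ht : Represents t f) (j k : ℕ) :
    Red (app (minStep t) (pair (numeral j) (numeral k)))
      (pair (numeral (f (k + 1))) (numeral (k + 1))) := by
  obtain ⟨-, hc, hr⟩ := ht
  have hk := closed_numeral k
  refine red_beta ((closed_numeral j).pair hk) ?_
  simp only [subst, lt_irrefl, if_true, closed_copy.subst_eq, closed_snd.subst_eq]
  refine red_letp ((Red.app (.refl _) (red_snd j hk)).trans (red_copy k)) hk hk ?_
  simpa [subst, numeral, hk.subst_eq, hc.subst_eq] using
    (hr (k + 1)).pair (Red.refl (numeral (k + 1)))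

theorem red_minTerm (ht : Represents t f) : Red (minTerm t) (minLoop f t 0) :=
  ((ht.2.2 0).pair (.refl _)).recur (.refl _) (.refl _) (.refl _)

theorem red_minLoop (ht : Represents t f) {k : ℕ} (hk : f k ≠ 0) :
    Red (minLoop f t k) (succ (minLoop f t (k + 1))) := by
  obtain ⟨j, hj⟩ := Nat.exists_eq_succ_of_ne_zero hk
  have hF := closed_minStep ht.2.1
  rw [minLoop, hj]
  refine (Step.rec_succ closed_lam_succ hF).red.trans (red_beta ?_ ?_)
  · exact (hF.app ((closed_numeral _).pair (closed_numeral _))).recur closed_zero closed_lam_succ hF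
  · exact ((red_minStep ht j k).recur (.refl _) (.refl _) (.refl _)).succ

theorem Red.iterate_succ {t t' : Term} (h : Red t t') :
    ∀ k, Red (Term.succ^[k] t) (Term.succ^[k] t')
  | 0 => h
  | k + 1 => Red.iterate_succ h.succ k

theorem red_minTerm_iterate (ht : Represents t f) :
    ∀ {k : ℕ}, (∀ i < k, f i ≠ 0) → Red (minTerm t) (succ^[k] (minLoop f t k))
  | 0, _ => red_minTerm ht
  | k + 1, h => (red_minTerm_iterate ht fun i hi => h i (by omega)).trans
      ((red_minLoop ht (h k (by omega))).iterate_succ k)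

theorem red_minTerm_numeral (ht : Represents t f) {m : ℕ} (h0 : f m = 0)
    (hlt : ∀ i < m, f i ≠ 0) : Red (minTerm t) (numeral m) := by
  refine (red_minTerm_iterate ht hlt).trans ?_
  rw [numeral_eq_iterate, minLoop, h0]
  exact (Step.rec_zero (closed_numeral m) closed_lam_succ
    (closed_minStep ht.2.1)).red.iterate_succ m

theorem diverges_minTerm (ht : Represents t f) (h : ∀ x, f x ≠ 0) : Diverges (minTerm t) :=
  diverges_of_forall_iterate_succ fun _ => ⟨_, red_minTerm_iterate ht fun i _ => h i⟩

end Minimisation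

end Term

/-! ### Typing -/

open Term

/-- The assignment `ρ` extended by the type `A` of a new variable with index `0`. -/
def assignCons (A : Ty) (ρ : ℕ → Ty) : ℕ → Ty
  | 0 => A
  | n + 1 => ρ n

/-- Simple typing with all structural rules: `ρ` gives a type to every variable, and premises share
`ρ`. Together with syntactic linearity it implies the linear typing (`STyped.hasType`), and it
avoids the splitting of environments. -/
inductive STyped : (ℕ → Ty) → Term → Ty → Prop
  | var {ρ : ℕ → Ty} {i : ℕ} {A : Ty} : ρ i = A → STyped ρ (var i) A
  | lam {ρ : ℕ → Ty} {t : Term} {A B : Ty} :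
      STyped (assignCons A ρ) t B → STyped ρ (lam t) (Ty.lolli A B)
  | app {ρ : ℕ → Ty} {t u : Term} {A B : Ty} :
      STyped ρ t (Ty.lolli A B) → STyped ρ u A → STyped ρ (app t u) B
  | pair {ρ : ℕ → Ty} {t u : Term} {A B : Ty} :
      STyped ρ t A → STyped ρ u B → STyped ρ (pair t u) (Ty.tensor A B)
  | letp {ρ : ℕ → Ty} {t u : Term} {A B C : Ty} :
      STyped ρ t (Ty.tensor A B) → STyped (assignCons B (assignCons A ρ)) u C →
      STyped ρ (letp t u) C
  | zero {ρ : ℕ → Ty} : STyped ρ zero Ty.nat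
  | succ {ρ : ℕ → Ty} {t : Term} : STyped ρ t Ty.nat → STyped ρ (succ t) Ty.nat
  | recur {ρ : ℕ → Ty} {t u v w : Term} {A : Ty} :
      STyped ρ t (Ty.tensor Ty.nat Ty.nat) → STyped ρ u A → STyped ρ v (Ty.lolli A A) →
      STyped ρ w (Ty.lolli (Ty.tensor Ty.nat Ty.nat) (Ty.tensor Ty.nat Ty.nat)) →
      STyped ρ (recur t u v w) A

theorem HasType.sTyped {Γ : Env} {t : Term} {A : Ty} (h : HasType Γ t A) :
    ∀ {ρ : ℕ → Ty}, (∀ i B, Γ i = some B → ρ i = B) → STyped ρ t A := by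
  have split {Γ Γ₁ Γ₂ : Env} (hs : Env.Split Γ Γ₁ Γ₂) {ρ : ℕ → Ty}
      (hρ : ∀ i B, Γ i = some B → ρ i = B) :
      (∀ i B, Γ₁ i = some B → ρ i = B) ∧ (∀ i B, Γ₂ i = some B → ρ i = B) := by
    constructor <;> intro i B hi <;> rcases hs i with ⟨h1, h2⟩ | ⟨h1, h2⟩ <;>
      exact hρ i B (by simp_all)
  have ext {Γ : Env} {A : Ty} {ρ : ℕ → Ty} (hρ : ∀ i B, Γ i = some B → ρ i = B) :
      ∀ i B, Γ.extend A i = some B → assignCons A ρ i = B := by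
    rintro (_ | i) B hi
    · simpa [Env.extend, assignCons] using hi
    · exact hρ i B hi
  induction h with
  | var i A => exact fun hρ => .var (hρ i A (by simp [Env.single]))
  | lam _ ih => exact fun hρ => .lam (ih (ext hρ))
  | app hs _ _ iht ihu =>
    exact fun hρ => .app (iht (split hs hρ).1) (ihu (split hs hρ).2)
  | pair hs _ _ iht ihu =>
    exact fun hρ => .pair (iht (split hs hρ).1) (ihu (split hs hρ).2)
  | letp hs _ _ iht ihu =>
    exact fun hρ => .letp (iht (split hs hρ).1) (ihu (ext (ext (split hs hρ).2)))
  | zero => exact fun _ => .zero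
  | succ _ ih => exact fun hρ => .succ (ih hρ)
  | recur hs hs' hs'' _ _ _ _ iht ihu ihv ihw =>
    intro ρ hρ
    obtain ⟨h1, hρ⟩ := split hs hρ
    obtain ⟨h2, hρ⟩ := split hs' hρ
    obtain ⟨h3, h4⟩ := split hs'' hρ
    exact .recur (iht h1) (ihu h2) (ihv h3) (ihw h4)

open Classical in
/-- The environment that types by `ρ` exactly the variables in `s`. -/
noncomputable def restrict (ρ : ℕ → Ty) (s : ℕ → Prop) : Env :=
  fun i => if s i then some (ρ i) else none

theorem split_restrict {ρ : ℕ → Ty} {s s₁ s₂ : ℕ → Prop} (h : ∀ i, s i ↔ s₁ i ∨ s₂ i)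
    (hd : ∀ i, ¬ (s₁ i ∧ s₂ i)) :
    Env.Split (restrict ρ s) (restrict ρ s₁) (restrict ρ s₂) := by
  intro i
  have := h i
  have := hd i
  by_cases h1 : s₁ i <;> by_cases h2 : s₂ i <;> simp_all [restrict]

theorem extend_restrict {ρ : ℕ → Ty} {A : Ty} {s : ℕ → Prop} (h : s 0) :
    (restrict ρ fun i => s (i + 1)).extend A = restrict (assignCons A ρ) s := by
  funext i
  cases i with
  | zero => simp [Env.extend, restrict, h, assignCons]
  | succ i => rfl

theorem STyped.hasType {ρ : ℕ → Ty} {t : Term} {A : Ty} (h : STyped ρ t A) :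
    Linear t → HasType (restrict ρ fun i => Free i t) t A := by
  induction h with
  | @var ρ i A h =>
    intro _
    convert HasType.var i A
    funext j
    simp only [restrict, Free, Env.single, eq_comm (a := i)]
    split
    · next hj => rw [hj, h]
    · rfl
  | lam _ ih =>
    intro hl
    have h := ih hl.1
    rw [← extend_restrict (s := fun i => Free i _) hl.2] at h
    exact .lam h
  | app _ _ iht ihu =>
    intro hl
    exact .app (split_restrict (fun _ => Iff.rfl) hl.2.2) (iht hl.1) (ihu hl.2.1)
  | pair _ _ iht ihu =>
    intro hl
    exact .pair (split_restrict (fun _ => Iff.rfl) hl.2.2) (iht hl.1) (ihu hl.2.1)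
  | letp _ _ iht ihu =>
    intro hl
    refine .letp (split_restrict (fun _ => Iff.rfl) hl.2.2.2.2) (iht hl.1) ?_
    rw [extend_restrict (s := fun i => Free (i + 1) _) hl.2.2.2.1,
      extend_restrict (s := fun i => Free i _) hl.2.2.1]
    exact ihu hl.2.1
  | zero =>
    intro _
    convert HasType.zero
    funext i
    simp [restrict, Free, Env.empty]
  | succ _ ih => exact fun hl => .succ (ih hl)
  | recur _ _ _ _ iht ihu ihv ihw =>
    intro ⟨ht, hu, hv, hw, htu, htv, htw, huv, huw, hvw⟩
    refine .recur (split_restrict (fun _ => Iff.rfl) ?_) (split_restrict (fun _ => Iff.rfl) ?_)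
      (split_restrict (fun _ => Iff.rfl) hvw) (iht ht) (ihu hu) (ihv hv) (ihw hw)
    · rintro i ⟨h, h' | h' | h'⟩
      · exact htu i ⟨h, h'⟩
      · exact htv i ⟨h, h'⟩
      · exact htw i ⟨h, h'⟩
    · rintro i ⟨h, h' | h'⟩
      · exact huv i ⟨h, h'⟩
      · exact huw i ⟨h, h'⟩

/-- `t` is a combinator of type `A`: a closed, syntactically linear, typable term. -/
structure Comb (t : Term) (A : Ty) : Prop where
  linear : Linear t
  closed : Closed t
  typed : ∀ ρ, STyped ρ t A

theorem Comb.hasType {t : Term} {A : Ty} (h : Comb t A) : HasType Env.empty t A := by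
  have := (h.typed fun _ => Ty.nat).hasType h.linear
  simp only [h.closed.free_iff] at this
  convert this
  funext i
  simp [restrict, Env.empty]

theorem comb_of_hasType {t : Term} {A : Ty} (hl : Linear t) (hc : Closed t)
    (h : HasType Env.empty t A) : Comb t A :=
  ⟨hl, hc, fun _ => h.sTyped fun _ _ hi => by simp [Env.empty] at hi⟩

theorem sTyped_I (ρ : ℕ → Ty) (A : Ty) : STyped ρ I (Ty.lolli A A) := .lam (.var rfl)

theorem STyped.discard {ρ : ℕ → Ty} {a r : Term} {A : Ty} (ha : STyped ρ a Ty.nat)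
    (hr : STyped ρ r A) : STyped ρ (discard a r) A :=
  .recur (.pair ha .zero) hr (sTyped_I _ _) (sTyped_I _ _)

theorem sTyped_snd (ρ : ℕ → Ty) :
    STyped ρ snd (Ty.lolli (Ty.tensor Ty.nat Ty.nat) Ty.nat) :=
  .lam (.letp (.var rfl) (.discard (.var rfl) (.var rfl)))

theorem comb_copy : Comb copy (Ty.lolli Ty.nat (Ty.tensor Ty.nat Ty.nat)) where
  linear := by simp [copy, I, Linear, Apart, Free]
  closed := closed_copy
  typed _ := .lam (.recur (.pair (.var rfl) .zero) (.pair .zero .zero)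
    (.lam (.letp (.var rfl) (.pair (.succ (.var rfl)) (.succ (.var rfl))))) (sTyped_I _ _))

theorem Comb.minTerm {t : Term} (h : Comb t (Ty.lolli Ty.nat Ty.nat)) :
    Comb (minTerm t) Ty.nat where
  linear := linear_minTerm h.linear h.closed
  closed := closed_minTerm h.closed
  typed _ := .recur (.pair (.app (h.typed _) .zero) .zero) .zero (.lam (.succ (.var rfl)))
    (.lam (.letp (.app (comb_copy.typed _) (.app (sTyped_snd _) (.var rfl)))
      (.pair (.app (h.typed _) (.succ (.var rfl))) (.succ (.var rfl)))))

/-! ### Tuples of numbers -/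

/-- The type of `k`-tuples of numbers, nested to the right and ended by a dummy number. -/
def tupleTy : ℕ → Ty
  | 0 => Ty.nat
  | k + 1 => Ty.tensor Ty.nat (tupleTy k)

namespace Term

/-- The tuple `⟨n₁, ⟨n₂, … ⟨n_k, 0⟩⟩⟩` of numerals. -/
def tuple : List ℕ → Term
  | [] => zero
  | n :: l => pair (numeral n) (tuple l)

/-- Copies a `k`-tuple. In the innermost body, variables `3` and `2` are the copies of the first
entry and `1` and `0` those of the remaining tuple. -/
def dup : ℕ → Term
  | 0 => copy
  | k + 1 => lam (letp (var 0) (letp (app copy (var 1)) (letp (app (dup k) (var 2))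
      (pair (pair (var 3) (var 1)) (pair (var 2) (var 0))))))

/-- Maps every `k`-tuple to `0`. -/
def erase : ℕ → Term
  | 0 => I
  | k + 1 => lam (letp (var 0) (discard (var 1) (app (erase k) (var 0))))

/-- The entry with index `i` of a `k`-tuple; the value at `k = 0` is immaterial. -/
def proj : ℕ → ℕ → Term
  | 0, _ => I
  | k + 1, 0 => lam (letp (var 0) (discard (app (erase k) (var 0)) (var 1)))
  | k + 1, i + 1 => lam (letp (var 0) (discard (var 1) (app (proj k i) (var 0))))

end Term

theorem comb_numeral : ∀ n, Comb (numeral n) Ty.nat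
  | 0 => ⟨trivial, closed_zero, fun _ => .zero⟩
  | n + 1 => ⟨(comb_numeral n).linear, closed_numeral _, fun ρ => .succ ((comb_numeral n).typed ρ)⟩

theorem comb_I (A : Ty) : Comb I (Ty.lolli A A) :=
  ⟨⟨trivial, rfl⟩, closed_I, fun ρ => sTyped_I ρ A⟩

theorem comb_tuple : ∀ l : List ℕ, Comb (tuple l) (tupleTy l.length)
  | [] => comb_numeral 0
  | n :: l =>
    ⟨⟨(comb_numeral n).linear, (comb_tuple l).linear, fun k h => closed_numeral n k h.1⟩,
      (closed_numeral n).pair (comb_tuple l).closed,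
      fun ρ => .pair ((comb_numeral n).typed ρ) ((comb_tuple l).typed ρ)⟩

theorem closed_tuple (l : List ℕ) : Closed (tuple l) := (comb_tuple l).closed

theorem comb_dup : ∀ k, Comb (dup k) (Ty.lolli (tupleTy k) (Ty.tensor (tupleTy k) (tupleTy k)))
  | 0 => comb_copy
  | k + 1 => by
    have ih := comb_dup k
    refine ⟨?_, ?_, fun ρ => ?_⟩
    · simp [dup, Linear, Apart, Free, comb_copy.linear, comb_copy.closed.free_iff, ih.linear,
        ih.closed.free_iff]
      omega
    · intro j
      simp [dup, Free, comb_copy.closed.free_iff, ih.closed.free_iff]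
    · exact .lam (.letp (.var rfl) (.letp (.app (comb_copy.typed _) (.var rfl))
        (.letp (.app (ih.typed _) (.var rfl))
          (.pair (.pair (.var rfl) (.var rfl)) (.pair (.var rfl) (.var rfl))))))

theorem red_dup : ∀ {k : ℕ} {l : List ℕ}, l.length = k →
    Red (app (dup k) (tuple l)) (pair (tuple l) (tuple l))
  | 0, [], _ => red_copy 0
  | k + 1, n :: l, h => by
    have ih := red_dup (Nat.succ.inj h)
    have hn := closed_numeral n
    have hl := closed_tuple l
    refine red_beta (hn.pair hl) ?_
    simp only [subst, lt_irrefl, if_true, closed_copy.subst_eq, (comb_dup k).closed.subst_eq]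
    refine red_letp (.refl _) hn hl ?_
    simp [subst, hn.subst_eq, hn.lift_eq, hl.lift_eq, closed_copy.subst_eq,
      (comb_dup k).closed.subst_eq]
    refine red_letp (red_copy n) hn hn ?_
    simp [subst, hn.subst_eq, hl.subst_eq, hn.lift_eq, (comb_dup k).closed.subst_eq]
    refine red_letp ih hl hl ?_
    simpa [subst, tuple, hn.subst_eq, hl.subst_eq] using
      Red.refl (pair (tuple (n :: l)) (tuple (n :: l)))

theorem comb_erase : ∀ k, Comb (erase k) (Ty.lolli (tupleTy k) Ty.nat)
  | 0 => comb_I _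
  | k + 1 => by
    have ih := comb_erase k
    refine ⟨?_, ?_, fun ρ => ?_⟩
    · simp [erase, Term.discard, I, Linear, Apart, Free, ih.linear, ih.closed.free_iff]
    · intro j
      simp [erase, Term.discard, I, Free, ih.closed.free_iff]
    · exact .lam (.letp (.var rfl) (.discard (.var rfl) (.app (ih.typed _) (.var rfl))))

theorem red_erase : ∀ {k : ℕ} {l : List ℕ}, l.length = k → Red (app (erase k) (tuple l)) zero
  | 0, [], _ => red_I closed_zero
  | k + 1, n :: l, h => by
    have hn := closed_numeral n
    have hl := closed_tuple l
    have he := (comb_erase k).closed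
    refine red_beta (hn.pair hl) ?_
    simp only [subst, lt_irrefl, if_true]
    refine red_letp (.refl _) hn hl ?_
    have : Red (discard (numeral n) (app (erase k) (tuple l))) zero :=
      (red_discard (.refl _) (he.app hl)).trans (red_erase (Nat.succ.inj h))
    simpa [subst, Term.discard, hn.subst_eq, he.subst_eq, closed_I.subst_eq] using this

theorem comb_proj : ∀ k i, Comb (proj k i) (Ty.lolli (tupleTy k) Ty.nat)
  | 0, _ => by
    rw [proj]
    exact comb_I _
  | k + 1, 0 => by
    have ih := comb_erase k
    refine ⟨?_, ?_, fun ρ => ?_⟩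
    · simp [proj, Term.discard, I, Linear, Apart, Free, ih.linear, ih.closed.free_iff]
    · intro j
      simp [proj, Term.discard, I, Free, ih.closed.free_iff]
    · exact .lam (.letp (.var rfl) (.discard (.app (ih.typed _) (.var rfl)) (.var rfl)))
  | k + 1, i + 1 => by
    have ih := comb_proj k i
    refine ⟨?_, ?_, fun ρ => ?_⟩
    · simp [proj, Term.discard, I, Linear, Apart, Free, ih.linear, ih.closed.free_iff]
    · intro j
      simp [proj, Term.discard, I, Free, ih.closed.free_iff]
    · exact .lam (.letp (.var rfl) (.discard (.var rfl) (.app (ih.typed _) (.var rfl))))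

theorem red_proj : ∀ {k i a : ℕ} {l : List ℕ}, l.length = k → l[i]? = some a →
    Red (app (proj k i) (tuple l)) (numeral a)
  | 0, i, a, [], _, hi => by simp at hi
  | k + 1, 0, a, n :: l, h, hi => by
    obtain rfl : n = a := by simpa using hi
    have hn := closed_numeral n
    have hl := closed_tuple l
    have he := (comb_erase k).closed
    refine red_beta (hn.pair hl) ?_
    simp only [subst, lt_irrefl, if_true]
    refine red_letp (.refl _) hn hl ?_
    have : Red (discard (app (erase k) (tuple l)) (numeral n)) (numeral n) :=
      red_discard (n := 0) (red_erase (Nat.succ.inj h)) hn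
    simpa [subst, Term.discard, hn.subst_eq, he.subst_eq, closed_I.subst_eq] using this
  | k + 1, i + 1, a, n :: l, h, hi => by
    have hn := closed_numeral n
    have hl := closed_tuple l
    have hp := (comb_proj k i).closed
    refine red_beta (hn.pair hl) ?_
    simp only [subst, lt_irrefl, if_true]
    refine red_letp (.refl _) hn hl ?_
    have : Red (discard (numeral n) (app (proj k i) (tuple l))) (numeral a) :=
      (red_discard (.refl _) (hp.app hl)).trans (red_proj (Nat.succ.inj h) (by simpa using hi))
    simpa [subst, Term.discard, hn.subst_eq, hp.subst_eq, closed_I.subst_eq] using this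

/-! ### Composition -/

namespace Term

/-- `λ x. let x = ⟨x₁, x₂⟩` (copies of the `k`-tuple `x`) `in` erase `g x₁`, then `t x₂`. -/
def guard (k : ℕ) (g t : Term) : Term :=
  lam (letp (app (dup k) (var 0)) (discard (app g (var 1)) (app t (var 0))))

/-- Evaluates and erases all of `gs` at a `k`-tuple before behaving as `t`. -/
def guards (k : ℕ) (t : Term) : List Term → Term
  | [] => t
  | g :: gs => guard k g (guards k t gs)

/-- Maps a `k`-tuple `x` to the tuple of the values of `gs` at `x`. -/
def tupling (k : ℕ) : List Term → Term
  | [] => erase k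
  | g :: gs => lam (letp (app (dup k) (var 0)) (pair (app g (var 1)) (app (tupling k gs) (var 0))))

/-- Composition of `t` with `gs`. The guards make it strict in every one of `gs`, whether or not `t`
needs its value. -/
def compose (k : ℕ) (t : Term) (gs : List Term) : Term :=
  guards k (lam (app t (app (tupling k gs) (var 0)))) gs

end Term

theorem Comb.guard {k : ℕ} {g t : Term} (hg : Comb g (Ty.lolli (tupleTy k) Ty.nat)) {A : Ty}
    (ht : Comb t (Ty.lolli (tupleTy k) A)) : Comb (guard k g t) (Ty.lolli (tupleTy k) A) := by
  have hd := comb_dup k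
  refine ⟨?_, ?_, fun ρ => ?_⟩
  · simp [Term.guard, Term.discard, I, Linear, Apart, Free, hd.linear, hd.closed.free_iff,
      hg.linear, hg.closed.free_iff, ht.linear, ht.closed.free_iff]
  · intro j
    simp [Term.guard, Term.discard, I, Free, hd.closed.free_iff, hg.closed.free_iff,
      ht.closed.free_iff]
  · exact .lam (.letp (.app (hd.typed _) (.var rfl))
      (.discard (.app (hg.typed _) (.var rfl)) (.app (ht.typed _) (.var rfl))))

theorem red_guard {k : ℕ} {g t : Term} (hg : Closed g) (ht : Closed t) {l : List ℕ}
    (h : l.length = k) :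
    Red (app (guard k g t) (tuple l)) (discard (app g (tuple l)) (app t (tuple l))) := by
  have hl := closed_tuple l
  refine red_beta hl ?_
  simp only [subst, lt_irrefl, if_true, (comb_dup k).closed.subst_eq]
  refine red_letp (red_dup h) hl hl ?_
  simpa [subst, Term.discard, hl.subst_eq, hg.subst_eq, ht.subst_eq, closed_I.subst_eq] using
    Red.refl (discard (app g (tuple l)) (app t (tuple l)))

theorem Comb.guards {k : ℕ} {t : Term} {A : Ty} (ht : Comb t (Ty.lolli (tupleTy k) A)) :
    ∀ {gs : List Term}, (∀ g ∈ gs, Comb g (Ty.lolli (tupleTy k) Ty.nat)) →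
      Comb (guards k t gs) (Ty.lolli (tupleTy k) A)
  | [], _ => ht
  | _ :: _, h =>
    (h _ List.mem_cons_self).guard (ht.guards fun _ hg => h _ (List.mem_cons_of_mem _ hg))

theorem red_guards {k : ℕ} {t : Term} {A : Ty} (ht : Comb t (Ty.lolli (tupleTy k) A)) {l : List ℕ}
    (hl : l.length = k) : ∀ {gs : List Term},
      (∀ g ∈ gs, Comb g (Ty.lolli (tupleTy k) Ty.nat)) →
      (∀ g ∈ gs, ∃ m, Red (app g (tuple l)) (numeral m)) →
      Red (app (guards k t gs) (tuple l)) (app t (tuple l))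
  | [], _, _ => .refl _
  | g :: gs, hc, hr => by
    obtain ⟨m, hm⟩ := hr g List.mem_cons_self
    have hc' : ∀ g ∈ gs, Comb g _ := fun _ hg => hc _ (List.mem_cons_of_mem _ hg)
    have hgs := (ht.guards hc').closed
    exact (red_guard (hc g List.mem_cons_self).closed hgs hl).trans <|
      (red_discard hm (hgs.app (closed_tuple l))).trans
        (red_guards ht hl hc' fun _ hg => hr _ (List.mem_cons_of_mem _ hg))

theorem diverges_guards {k : ℕ} {t : Term} {A : Ty} (ht : Comb t (Ty.lolli (tupleTy k) A))
    {l : List ℕ} (hl : l.length = k) : ∀ {gs : List Term},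
      (∀ g ∈ gs, Comb g (Ty.lolli (tupleTy k) Ty.nat)) →
      (∀ g ∈ gs, (∃ m, Red (app g (tuple l)) (numeral m)) ∨ Diverges (app g (tuple l))) →
      (∃ g ∈ gs, Diverges (app g (tuple l))) → Diverges (app (guards k t gs) (tuple l))
  | [], _, _, h => by simp at h
  | g :: gs, hc, hr, hd => by
    have hc' : ∀ g ∈ gs, Comb g _ := fun _ hg => hc _ (List.mem_cons_of_mem _ hg)
    have hgs := (ht.guards hc').closed
    refine .of_red (red_guard (hc g List.mem_cons_self).closed hgs hl) ?_
    by_cases hg : Diverges (app g (tuple l))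
    · exact hg.discard _
    · obtain ⟨m, hm⟩ := (hr g List.mem_cons_self).resolve_right hg
      refine .of_red (red_discard hm (hgs.app (closed_tuple l))) ?_
      refine diverges_guards ht hl hc' (fun _ hg => hr _ (List.mem_cons_of_mem _ hg)) ?_
      obtain ⟨g', hg', hd⟩ := hd
      rcases List.mem_cons.1 hg' with rfl | hg'
      · exact (hg hd).elim
      · exact ⟨g', hg', hd⟩

theorem comb_tupling {k : ℕ} : ∀ {gs : List Term},
    (∀ g ∈ gs, Comb g (Ty.lolli (tupleTy k) Ty.nat)) →
      Comb (tupling k gs) (Ty.lolli (tupleTy k) (tupleTy gs.length))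
  | [], _ => comb_erase k
  | g :: gs, h => by
    have hg := h _ List.mem_cons_self
    have ih := comb_tupling (k := k) (gs := gs) fun _ hg => h _ (List.mem_cons_of_mem _ hg)
    have hd := comb_dup k
    refine ⟨?_, ?_, fun ρ => ?_⟩
    · simp [tupling, Linear, Apart, Free, hd.linear, hd.closed.free_iff, hg.linear,
        hg.closed.free_iff, ih.linear, ih.closed.free_iff]
    · intro j
      simp [tupling, Free, hd.closed.free_iff, hg.closed.free_iff, ih.closed.free_iff]
    · exact .lam (.letp (.app (hd.typed _) (.var rfl))
        (.pair (.app (hg.typed _) (.var rfl)) (.app (ih.typed _) (.var rfl))))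

theorem red_tupling {k : ℕ} {l : List ℕ} (hl : l.length = k) {gs : List Term} {ms : List ℕ}
    (hr : List.Forall₂ (fun g m => Red (app g (tuple l)) (numeral m)) gs ms)
    (hc : ∀ g ∈ gs, Comb g (Ty.lolli (tupleTy k) Ty.nat)) :
    Red (app (tupling k gs) (tuple l)) (tuple ms) := by
  induction hr with
  | nil => exact red_erase hl
  | @cons g m gs ms hg _ ih =>
    have hc' : ∀ g ∈ gs, Comb g _ := fun _ hg => hc _ (List.mem_cons_of_mem _ hg)
    have ht := closed_tuple l
    refine red_beta ht ?_
    simp only [subst, lt_irrefl, if_true, (comb_dup k).closed.subst_eq]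
    refine red_letp (red_dup hl) ht ht ?_
    simpa [subst, tuple, ht.subst_eq, (hc g List.mem_cons_self).closed.subst_eq,
      (comb_tupling hc').closed.subst_eq] using hg.pair (ih hc')

/-! ### Primitive recursion and minimisation with parameters -/

namespace Term

/-- One round of primitive recursion on tuples: `⟨y, ⟨h, p⟩⟩ ↦ ⟨y + 1, ⟨g ⟨y, ⟨h, p⟩⟩, p⟩⟩`.
In the innermost body, `h` is variable `5`, the copies of `y` are `3` and `2`, those of `p` are `1`
and `0`. -/
def precStep (k : ℕ) (g : Term) : Term :=
  lam (letp (var 0) (letp (var 0) (letp (app copy (var 3)) (letp (app (dup k) (var 2))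
    (pair (succ (var 3))
      (pair (app g (pair (var 2) (pair (var 5) (var 1)))) (var 0)))))))

/-- Primitive recursion: iterates `precStep` from `⟨0, ⟨f p, p⟩⟩`, where `p` is the tuple of
parameters, and takes the second component of the result. -/
def prec (k : ℕ) (f g : Term) : Term :=
  lam (letp (var 0) (app (proj (k + 2) 1) (recur (pair (var 1) zero)
    (letp (app (dup k) (var 0)) (pair zero (pair (app f (var 1)) (var 0))))
    (precStep k g) I)))

/-- The open form of `minTerm (λ y. f ⟨y, x⟩)`, abstracted over the tuple `x` of parameters, which
has to be copied because `minTerm` mentions its argument twice. -/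
def rfind (k : ℕ) (f : Term) : Term :=
  lam (letp (app (dup k) (var 0))
    (recur (pair (app (lam (app f (pair (var 0) (var 2)))) zero) zero) zero (lam (succ (var 0)))
      (lam (letp (app copy (app snd (var 0)))
        (pair (app (lam (app f (pair (var 0) (var 4)))) (succ (var 1))) (succ (var 0)))))))

end Term

theorem comb_precStep {k : ℕ} {g : Term} (hg : Comb g (Ty.lolli (tupleTy (k + 2)) Ty.nat)) :
    Comb (precStep k g) (Ty.lolli (tupleTy (k + 2)) (tupleTy (k + 2))) := by
  have hd := comb_dup k
  have hc := comb_copy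
  refine ⟨?_, ?_, fun ρ => ?_⟩
  · simp [precStep, Linear, Apart, Free, hd.linear, hd.closed.free_iff, hg.linear,
      hg.closed.free_iff, hc.linear, hc.closed.free_iff]
    grind
  · intro j
    simp [precStep, Free, hd.closed.free_iff, hg.closed.free_iff, hc.closed.free_iff]
  · exact .lam (.letp (.var rfl) (.letp (.var rfl) (.letp (.app (hc.typed _) (.var rfl))
      (.letp (.app (hd.typed _) (.var rfl)) (.pair (.succ (.var rfl))
        (.pair (.app (hg.typed _) (.pair (.var rfl) (.pair (.var rfl) (.var rfl))))
          (.var rfl)))))))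

theorem red_precStep {k : ℕ} {g : Term} (hg : Closed g) {y h m : ℕ} {l : List ℕ}
    (hl : l.length = k) (hr : Red (app g (tuple (y :: h :: l))) (numeral m)) :
    Red (app (precStep k g) (tuple (y :: h :: l))) (tuple ((y + 1) :: m :: l)) := by
  have hd := (comb_dup k).closed
  have cy := closed_numeral y
  have ch := closed_numeral h
  have cl := closed_tuple l
  have hc := closed_copy
  refine red_beta (closed_tuple _) ?_
  simp only [subst, lt_irrefl, if_true]
  refine red_letp (.refl _) cy (ch.pair cl) ?_
  simp [subst, cy.lift_eq, cy.subst_eq, hc.subst_eq, hd.subst_eq, hg.subst_eq]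
  refine red_letp (.refl _) ch cl ?_
  simp [subst, cy.subst_eq, ch.lift_eq, cl.lift_eq, ch.subst_eq,
    hc.subst_eq, hd.subst_eq, hg.subst_eq]
  refine red_letp (red_copy y) cy cy ?_
  simp [subst, cy.lift_eq, cy.subst_eq, ch.subst_eq, cl.subst_eq, hd.subst_eq, hg.subst_eq]
  refine red_letp (red_dup hl) cl cl ?_
  simp [subst, cy.subst_eq, ch.subst_eq, cl.subst_eq, hg.subst_eq]
  exact Red.pair (.refl (numeral (y + 1))) (hr.pair (.refl _))

theorem comb_prec {k : ℕ} {f g : Term} (hf : Comb f (Ty.lolli (tupleTy k) Ty.nat))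
    (hg : Comb g (Ty.lolli (tupleTy (k + 2)) Ty.nat)) :
    Comb (prec k f g) (Ty.lolli (tupleTy (k + 1)) Ty.nat) := by
  have hd := comb_dup k
  have hp := comb_proj (k + 2) 1
  have hs := comb_precStep hg
  refine ⟨?_, ?_, fun ρ => ?_⟩
  · simp [prec, I, Linear, Apart, Free, hd.linear, hd.closed.free_iff, hf.linear,
      hf.closed.free_iff, hp.linear, hp.closed.free_iff, hs.linear, hs.closed.free_iff]
  · intro j
    simp [prec, I, Free, hd.closed.free_iff, hf.closed.free_iff, hp.closed.free_iff,
      hs.closed.free_iff]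
  · exact .lam (.letp (.var rfl) (.app (hp.typed _) (.recur (.pair (.var rfl) .zero)
      (.letp (.app (hd.typed _) (.var rfl))
        (.pair .zero (.pair (.app (hf.typed _) (.var rfl)) (.var rfl))))
      (hs.typed _) (sTyped_I _ _))))

theorem red_prec {k : ℕ} {f g : Term} (hf : Closed f)
    (hg : Comb g (Ty.lolli (tupleTy (k + 2)) Ty.nat)) {l : List ℕ} (hl : l.length = k)
    {F : ℕ → ℕ} (h0 : Red (app f (tuple l)) (numeral (F 0)))
    (hs : ∀ y, Red (app g (tuple (y :: F y :: l))) (numeral (F (y + 1)))) (n : ℕ) :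
    Red (app (prec k f g) (tuple (n :: l))) (numeral (F n)) := by
  have hd := (comb_dup k).closed
  have hp := (comb_proj (k + 2) 1).closed
  have hs' := (comb_precStep hg).closed
  have cn := closed_numeral n
  have cl := closed_tuple l
  refine red_beta (closed_tuple _) ?_
  simp only [subst, lt_irrefl, if_true]
  refine red_letp (.refl _) cn cl ?_
  simp [subst, cn.lift_eq, cn.subst_eq, cl.lift_eq, hd.subst_eq, hf.subst_eq,
    hp.subst_eq, hs'.subst_eq, closed_I.subst_eq]
  refine Red.trans (Red.app (.refl _)
    (red_iterate (g := fun y => tuple (y :: F y :: l)) hs' ?_ (fun y => ?_) n))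
    (red_proj (by simp [hl]) rfl)
  · refine red_letp (red_dup hl) cl cl ?_
    simpa [subst, tuple, numeral, cl.subst_eq, hf.subst_eq] using
      Red.pair (.refl zero) (h0.pair (.refl (tuple l)))
  · exact red_precStep hg.closed hl (hs y)

theorem comb_rfind {k : ℕ} {f : Term} (hf : Comb f (Ty.lolli (tupleTy (k + 1)) Ty.nat)) :
    Comb (rfind k f) (Ty.lolli (tupleTy k) Ty.nat) := by
  have hd := comb_dup k
  have hc := comb_copy
  refine ⟨?_, ?_, fun ρ => ?_⟩
  · simp [rfind, snd, I, Linear, Apart, Free, hd.linear, hd.closed.free_iff, hf.linear,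
      hf.closed.free_iff, hc.linear, hc.closed.free_iff]
  · intro j
    simp [rfind, Free, hd.closed.free_iff, hf.closed.free_iff, hc.closed.free_iff,
      closed_snd.free_iff]
  · exact .lam (.letp (.app (hd.typed _) (.var rfl)) (.recur
      (.pair (.app (.lam (.app (hf.typed _) (.pair (.var rfl) (.var rfl)))) .zero) .zero) .zero
      (.lam (.succ (.var rfl)))
      (.lam (.letp (.app (hc.typed _) (.app (sTyped_snd _) (.var rfl)))
        (.pair (.app (.lam (.app (hf.typed _) (.pair (.var rfl) (.var rfl)))) (.succ (.var rfl)))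
          (.succ (.var rfl)))))))

theorem red_rfind {k : ℕ} {f : Term} (hf : Closed f) {l : List ℕ} (hl : l.length = k) :
    Red (app (rfind k f) (tuple l)) (minTerm (lam (app f (pair (var 0) (tuple l))))) := by
  have cl := closed_tuple l
  refine red_beta cl ?_
  simp [subst, cl.lift_eq, (comb_dup k).closed.subst_eq, hf.subst_eq, closed_copy.subst_eq,
    closed_snd.subst_eq]
  refine red_letp (red_dup hl) cl cl ?_
  simp [subst, cl.lift_eq, cl.subst_eq, hf.subst_eq, closed_copy.subst_eq, closed_snd.subst_eq]
  exact .refl _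

theorem represents_section {k : ℕ} {f : Term} (hf : Comb f (Ty.lolli (tupleTy (k + 1)) Ty.nat))
    {l : List ℕ} {F : ℕ → ℕ} (h : ∀ n, Red (app f (tuple (n :: l))) (numeral (F n))) :
    Represents (lam (app f (pair (var 0) (tuple l)))) F := by
  have cl := closed_tuple l
  refine ⟨?_, ?_, fun n => red_beta (closed_numeral n) ?_⟩
  · simp [Linear, Apart, Free, hf.linear, hf.closed.free_iff, (comb_tuple l).linear, cl.free_iff]
  · intro j
    simp [Free, hf.closed.free_iff, cl.free_iff]
  · simpa [subst, tuple, hf.closed.subst_eq, cl.subst_eq] using h n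

/-! ### Currying -/

namespace Term

/-- Turns a function on `k`-tuples into a function of `k` arguments:
`curry (k + 1) = λ f. λ x. curry k (λ y. f ⟨x, y⟩)`. -/
def curry : ℕ → Term
  | 0 => lam (app (var 0) zero)
  | k + 1 => lam (lam (app (curry k) (lam (app (var 2) (pair (var 1) (var 0))))))

end Term

theorem comb_curry : ∀ k, Comb (curry k) (Ty.lolli (Ty.lolli (tupleTy k) Ty.nat) (natFun k))
  | 0 => by
    refine ⟨?_, ?_, fun ρ => .lam (.app (.var rfl) .zero)⟩
    · simp [curry, Linear, Apart, Free]
    · intro j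
      simp [curry, Free]
  | k + 1 => by
    have ih := comb_curry k
    refine ⟨?_, ?_, fun ρ => ?_⟩
    · simp [curry, Linear, Apart, Free, ih.linear, ih.closed.free_iff]
    · intro j
      simp [curry, Free, ih.closed.free_iff]
    · exact .lam (.lam (.app (ih.typed _)
        (.lam (.app (.var rfl) (.pair (.var rfl) (.var rfl))))))

theorem Term.Red.appNumerals {t u : Term} (h : Red t u) (l : List ℕ) :
    Red (t.appNumerals l) (u.appNumerals l) := by
  induction l generalizing t u with
  | nil => exact h
  | cons n l ih => exact ih (h.app (.refl _))

theorem red_curry : ∀ {k : ℕ} {l : List ℕ}, l.length = k → ∀ {t : Term}, Closed t →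
    Red ((app (curry k) t).appNumerals l) (app t (tuple l))
  | 0, [], _, t, ht => by
    refine red_beta ht ?_
    simpa [subst, tuple] using Red.refl (app t zero)
  | k + 1, n :: l, hl, t, ht => by
    have hn := closed_numeral n
    have ct := closed_tuple l
    have hc := (comb_curry k).closed
    have h1 : Red (app (app (curry (k + 1)) t) (numeral n))
        (app (curry k) (lam (app t (pair (numeral n) (var 0))))) := by
      refine (Red.app (red_beta ht (.refl _)) (.refl _)).trans ?_
      simp only [subst, ht.lift_eq, hc.subst_eq]
      refine red_beta hn ?_
      simpa [subst, hn.lift_eq, hc.subst_eq, ht.subst_eq] using Red.refl _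
    refine (h1.appNumerals l).trans ((red_curry (Nat.succ.inj hl) ?_).trans (red_beta ct ?_))
    · intro j
      simp [Free, ht.free_iff, hn.free_iff]
    · simpa [subst, tuple, ht.subst_eq, hn.subst_eq] using Red.refl (app t (tuple (n :: l)))

/-! ### Partial recursive functions -/

/-- The combinator `t` computes `h` on tuples of numerals. -/
structure Computes {k : ℕ} (t : Term) (h : List.Vector ℕ k →. ℕ) : Prop where
  comb : Comb t (Ty.lolli (tupleTy k) Ty.nat)
  red : ∀ x, ∀ m ∈ h x, Red (app t (tuple x.toList)) (numeral m)
  diverges : ∀ x, ¬ (h x).Dom → Diverges (app t (tuple x.toList))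

theorem Computes.red_or_diverges {k : ℕ} {t : Term} {h : List.Vector ℕ k →. ℕ}
    (ht : Computes t h) (x : List.Vector ℕ k) :
    (∃ m, Red (app t (tuple x.toList)) (numeral m)) ∨ Diverges (app t (tuple x.toList)) := by
  by_cases hx : (h x).Dom
  · exact .inl ⟨_, ht.red x _ (Part.get_mem hx)⟩
  · exact .inr (ht.diverges x hx)

theorem computes_total {k : ℕ} {t : Term} {f : List.Vector ℕ k → ℕ}
    (hc : Comb t (Ty.lolli (tupleTy k) Ty.nat))
    (hr : ∀ x, Red (app t (tuple x.toList)) (numeral (f x))) :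
    Computes t (f : List.Vector ℕ k →. ℕ) where
  comb := hc
  red x m hm := by
    obtain rfl : m = f x := by simpa using hm
    exact hr x
  diverges x hx := (hx trivial).elim

theorem Computes.red_total {k : ℕ} {t : Term} {f : List.Vector ℕ k → ℕ}
    (h : Computes t (f : List.Vector ℕ k →. ℕ)) (x : List.Vector ℕ k) :
    Red (app t (tuple x.toList)) (numeral (f x)) := h.red x _ (by simp)

theorem mem_mOfFn {α : Type*} : ∀ {n : ℕ} {g : Fin n → Part α} {y : List.Vector α n},
    y ∈ List.Vector.mOfFn g ↔ ∀ i, y.get i ∈ g i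
  | 0, g, y => by
    simp [List.Vector.mOfFn, Part.pure_eq_some, Part.mem_some_iff, List.Vector.eq_nil y]
  | n + 1, g, y => by
    rw [Fin.forall_fin_succ, ← List.Vector.cons_head_tail y]
    simp only [List.Vector.mOfFn, Part.bind_eq_bind, Part.mem_bind_iff, mem_mOfFn,
      Part.pure_eq_some, Part.mem_some_iff, List.Vector.get_zero, List.Vector.head_cons,
      List.Vector.get_cons_succ]
    constructor
    · rintro ⟨a, ha, v, hv, h⟩
      have h1 := congrArg List.Vector.head h
      have h2 := congrArg List.Vector.tail h
      simp only [List.Vector.head_cons, List.Vector.tail_cons] at h1 h2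
      rw [h1, h2]
      exact ⟨ha, hv⟩
    · rintro ⟨ha, hv⟩
      exact ⟨_, ha, _, hv, rfl⟩

theorem Computes.compose {m n : ℕ} {t : Term} {f : List.Vector ℕ n →. ℕ} (ht : Computes t f)
    {u : Fin n → Term} {g : Fin n → List.Vector ℕ m →. ℕ} (hu : ∀ i, Computes (u i) (g i)) :
    Computes (compose m t (List.ofFn u)) fun v => (List.Vector.mOfFn fun i => g i v) >>= f := by
  have hgs : ∀ s ∈ List.ofFn u, Comb s (Ty.lolli (tupleTy m) Ty.nat) := by
    simpa [List.mem_ofFn'] using fun i => (hu i).comb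
  have htup := comb_tupling hgs
  rw [List.length_ofFn] at htup
  have hct : Comb (lam (app t (app (tupling m (List.ofFn u)) (var 0))))
      (Ty.lolli (tupleTy m) Ty.nat) := by
    refine ⟨?_, ?_, fun ρ => .lam (.app (ht.comb.typed _) (.app (htup.typed _) (.var rfl)))⟩
    · simp [Linear, Apart, Free, ht.comb.linear, ht.comb.closed.free_iff, htup.linear,
        htup.closed.free_iff]
    · intro j
      simp [Free, ht.comb.closed.free_iff, htup.closed.free_iff]
  have key : ∀ x y, y ∈ List.Vector.mOfFn (fun i => g i x) →
      Red (app (Term.compose m t (List.ofFn u)) (tuple x.toList)) (app t (tuple y.toList)) := by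
    intro x y hy
    rw [mem_mOfFn] at hy
    have hr : ∀ i, Red (app (u i) (tuple x.toList)) (numeral (y.get i)) :=
      fun i => (hu i).red x _ (hy i)
    refine (red_guards hct x.toList_length hgs ?_).trans (red_beta (closed_tuple _) ?_)
    · simpa [List.mem_ofFn'] using fun i => ⟨_, hr i⟩
    · simp only [subst, lt_irrefl, if_true, ht.comb.closed.subst_eq, htup.closed.subst_eq]
      refine Red.app (.refl _) (red_tupling x.toList_length ?_ hgs)
      rw [List.forall₂_iff_get]
      refine ⟨by simp, fun i h1 h2 => ?_⟩
      simpa [List.Vector.get_eq_get_toList] using hr ⟨i, by simpa using h1⟩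
  refine ⟨hct.guards hgs, fun x a ha => ?_, fun x hx => ?_⟩
  · obtain ⟨y, hy, ha⟩ := Part.mem_bind_iff.1 ha
    exact (key x y hy).trans (ht.red y a ha)
  · by_cases hd : ∀ i, (g i x).Dom
    · have hy : List.Vector.ofFn (fun i => (g i x).get (hd i)) ∈
          List.Vector.mOfFn fun i => g i x := by
        rw [mem_mOfFn]
        intro i
        simpa using Part.get_mem (hd i)
      refine .of_red (key x _ hy) (ht.diverges _ fun h => hx ?_)
      exact Part.dom_iff_mem.2 ⟨_, Part.mem_bind_iff.2 ⟨_, hy, Part.get_mem h⟩⟩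
    · push Not at hd
      obtain ⟨i, hi⟩ := hd
      refine diverges_guards hct x.toList_length hgs ?_
        ⟨u i, (List.mem_ofFn' _ _).2 ⟨i, rfl⟩, (hu i).diverges x hi⟩
      simpa [List.mem_ofFn'] using fun i => (hu i).red_or_diverges x

theorem Computes.rfind {k : ℕ} {t : Term} {f : List.Vector ℕ (k + 1) → ℕ}
    (ht : Computes t (f : List.Vector ℕ (k + 1) →. ℕ)) :
    Computes (rfind k t) fun v => Nat.rfind fun n => Part.some (f (n ::ᵥ v) = 0) := by
  have hrep (x : List.Vector ℕ k) :
      Represents (lam (app t (pair (var 0) (tuple x.toList)))) fun n => f (n ::ᵥ x) :=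
    represents_section ht.comb fun n => by simpa using ht.red_total (n ::ᵥ x)
  have hred (x : List.Vector ℕ k) := red_rfind (l := x.toList) ht.comb.closed x.toList_length
  refine ⟨comb_rfind ht.comb, fun x m hm => ?_, fun x hx => ?_⟩
  · obtain ⟨h0, hlt⟩ := Nat.mem_rfind.1 hm
    refine (hred x).trans (red_minTerm_numeral (hrep x) ?_ fun i hi => ?_)
    · simpa using h0
    · simpa using hlt hi
  · refine .of_red (hred x) (diverges_minTerm (hrep x) fun n hn => hx ?_)
    exact Nat.rfind_dom.2 ⟨n, by simpa using hn, fun _ => trivial⟩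

/-- The successor of the only entry of a `1`-tuple. -/
def Term.tupleSucc : Term := lam (succ (app (proj 1 0) (var 0)))

theorem computes_tupleSucc :
    Computes tupleSucc ((fun v => v.head.succ : List.Vector ℕ 1 → ℕ) : List.Vector ℕ 1 →. ℕ) := by
  have hp := comb_proj 1 0
  refine computes_total ⟨?_, ?_, fun ρ => .lam (.succ (.app (hp.typed _) (.var rfl)))⟩ fun x => ?_
  · simp [tupleSucc, Linear, Apart, Free, hp.linear, hp.closed.free_iff]
  · intro j
    simp [tupleSucc, Free, hp.closed.free_iff]
  · refine red_beta (closed_tuple _) ?_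
    simp only [subst, lt_irrefl, if_true, hp.closed.subst_eq]
    refine Red.succ (red_proj x.toList_length ?_)
    rw [← List.Vector.cons_head_tail x]
    simp

theorem exists_computes_of_primrec {k : ℕ} {f : List.Vector ℕ k → ℕ} (hf : Nat.Primrec' f) :
    ∃ t, Computes t (f : List.Vector ℕ k →. ℕ) := by
  induction hf with
  | zero =>
    refine ⟨I, computes_total (comb_I _) fun x => ?_⟩
    rw [List.Vector.eq_nil x]
    exact red_I closed_zero
  | succ => exact ⟨_, computes_tupleSucc⟩
  | @get k i =>
    refine ⟨proj k i, computes_total (comb_proj k i) fun x => red_proj x.toList_length ?_⟩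
    simp [List.Vector.get_eq_get_toList]
  | @comp m n f g _ _ ihf ihg =>
    obtain ⟨t, ht⟩ := ihf
    choose u hu using ihg
    have h : (fun v => (List.Vector.mOfFn fun i => (g i : List.Vector ℕ m →. ℕ) v) >>=
        (f : List.Vector ℕ n →. ℕ)) =
        ((fun v => f (List.Vector.ofFn fun i => g i v) : List.Vector ℕ m → ℕ) :
          List.Vector ℕ m →. ℕ) := by
      funext v
      simp only [PFun.coe_val, Vector.mOfFn_part_some]
      exact Part.bind_some _ _
    exact ⟨_, h ▸ Computes.compose ht hu⟩
  | @prec k f g _ _ ihf ihg =>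
    obtain ⟨t, ht⟩ := ihf
    obtain ⟨u, hu⟩ := ihg
    refine ⟨_, computes_total (comb_prec ht.comb hu.comb) fun x => ?_⟩
    rw [← List.Vector.cons_head_tail x]
    simp only [List.Vector.toList_cons, List.Vector.head_cons, List.Vector.tail_cons]
    exact red_prec ht.comb.closed hu.comb x.tail.toList_length 
      (F := fun n => n.rec (f x.tail) fun y h => g (y ::ᵥ h ::ᵥ x.tail))
      (ht.red_total _) (fun y => by simpa using hu.red_total (y ::ᵥ _ ::ᵥ x.tail)) x.head

theorem exists_computes_of_partrec {k : ℕ} {h : List.Vector ℕ k →. ℕ} (hh : Nat.Partrec' h) :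
    ∃ t, Computes t h := by
  induction hh with
  | prim hf => exact exists_computes_of_primrec hf
  | comp g _ _ ihf ihg =>
    obtain ⟨t, ht⟩ := ihf
    choose u hu using ihg
    exact ⟨_, ht.compose hu⟩
  | rfind _ ih =>
    obtain ⟨t, ht⟩ := ih
    exact ⟨_, ht.rfind⟩

theorem Computes.defines {k : ℕ} {t : Term} {h : List.Vector ℕ k →. ℕ} (ht : Computes t h) :
    Defines (app (curry k) t) h := by
  have hc := comb_curry k
  have hcomb : Comb (app (curry k) t) (natFun k) :=
    ⟨⟨hc.linear, ht.comb.linear, fun i hi => hc.closed i hi.1⟩, hc.closed.app ht.comb.closed,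
      fun ρ => .app (hc.typed ρ) (ht.comb.typed ρ)⟩
  refine ⟨hcomb.linear, hcomb.closed, hcomb.hasType, fun x => ?_⟩
  have hr := red_curry x.toList_length ht.comb.closed
  exact ⟨fun m hm => hr.trans (ht.red x m hm), fun hx => .of_red hr (ht.diverges x hx)⟩

end Lrec

theorem mainTheorem1 :
    (∀ (f : ℕ → ℕ) (fbar : Lrec.Term), fbar.Represents f →
      (Lrec.Term.minTerm fbar).Linear ∧ (Lrec.Term.minTerm fbar).Closed ∧
      (Lrec.HasType Lrec.Env.empty fbar (Lrec.Ty.lolli Lrec.Ty.nat Lrec.Ty.nat) →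
        Lrec.HasType Lrec.Env.empty (Lrec.Term.minTerm fbar) Lrec.Ty.nat) ∧
      (∀ m : ℕ, IsLeast {x : ℕ | f x = 0} m →
        (Lrec.Term.minTerm fbar).Red (Lrec.Term.numeral m)) ∧
      ((∀ x : ℕ, f x ≠ 0) → (Lrec.Term.minTerm fbar).Diverges)) ∧
    (∀ (k : ℕ) (h : List.Vector ℕ k →. ℕ), Nat.Partrec' h →
      ∃ t : Lrec.Term, Lrec.Defines t h) := by
  refine ⟨fun f t ht => ⟨Lrec.Term.linear_minTerm ht.1 ht.2.1, Lrec.Term.closed_minTerm ht.2.1,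
    fun h => (Lrec.comb_of_hasType ht.1 ht.2.1 h).minTerm.hasType, fun m hm => ?_,
    Lrec.Term.diverges_minTerm ht⟩, fun k h hh => ?_⟩
  · exact Lrec.Term.red_minTerm_numeral ht hm.1 fun i hi h0 => hi.not_ge (hm.2 h0)
  · obtain ⟨t, ht⟩ := Lrec.exists_computes_of_partrec hh
    exact ⟨_, ht.defines⟩
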